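/- **Setting.** For $p\in\mathbb N$ and $\theta\in\mathbb R^p$ let $P_\theta=N(\theta,I_p)$, with density $p(Y|\theta)$. For $S\subset[p]=\{1,\dots,p\}$ let $\Theta_S=\{\theta\in\mathbb R^p:\theta_j=0\text{ for all }j\notin S\}$. Fix $\tau>0$ and let $G$ be the Laplace distribution with density $\frac{\tau}{2}e^{-\tau|x|}$. For $\lambda\in[0,1]$ let $$\Pi_\lambda=\bigotimes_{j=1}^p\big((1-\lambda)\delta_0+\lambda G\big)=\sum_{S\subset[p]}\nu_\lambda(S)\,\Gamma_S,\qquad \nu_\lambda(S)=(1-\lambda)^{p-|S|}\lambda^{|S|},\qquad \Gamma_S=\Big(\bigotimes_{j\in S^c}\delta_0\Big)\otimes\Big(\bigotimes_{j\in S}G\Big),$$ and let $\Pi_\lambda(B|Y)=\int_B p(Y|\theta)\,d\Pi_\lambda(\theta)\big/\int p(Y|\theta)\,d\Pi_\lambda(\theta)$ be the posterior. Let $w(\lambda)=\lambda^{\alpha-1}(1-\lambda)^{\beta-1}$ and let $\widehat\lambda=\widehat\lambda(Y)$ be any maximizer over $\lambda\in[0,1]$ of $\log\big[w(\lambda)\int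 p(Y|\theta)\,d\Pi_\lambda(\theta)\big]$. Put $\gamma(S)=\max_{\lambda\in[0,1]}w(\lambda)\nu_\lambda(S)$, and for two probability measures let $D_2(P\|Q)=\log\int\frac{dP}{dQ}\,dP$. **Theorem.** For every $\tau>0$ there are constants $C,C_1,C_2,C_3,C_5,K>0$ with $C>2C_5$, depending only on $\tau$, such that for all $C_1'>C_2'\ge K$ there are constants $C_4,M,C'>0$, depending only on $\tau,C_1',C_2'$, with the following property. Let $p\in\mathbb N$, $\alpha\ge 1$ and $p^{C_1'}\ge\beta/\alpha\ge p^{C_2'}$, let $S^*\subset[p]$ and $\theta^*\in\Theta_{S^*}$. 1. If $p\ge 2$ and $S^*\neq\varnothing$, then: * (testing) there is a measurable $\phi:\mathbb R^p\to[0,1]$ such that $P_{\theta^*}\phi\le \exp(-C_1|S^*|\log p)$ and, for every $\epsilon^2\ge|S^*|\log p$ and $S\subset[p]$, $$\sup_{\theta\in\Theta_S:\ \|\theta-\theta^*\|^2\ge\epsilon^2}P_\theta(1-\phi)\le\exp\big(-C\epsilon^2+C_2(|S|+|S^*|)\log p\big);$$ * (complexity) the maxima $\gamma(S)$ exist and there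 is $\lambda^*\in[0,1]$ with $w(\lambda^*)\nu_{\lambda^*}(S^*)>0$ and $$\sum_{S\subset[p]}\frac{\gamma(S)}{w(\lambda^*)\nu_{\lambda^*}(S^*)}\exp\big(2C_2|S|\log p\big)\le\exp\big(C_4|S^*|\log p\big);$$ * (prior mass ratio) for every $\epsilon^2\ge|S^*|\log p$ and $S\subset[p]$, $$\frac{\Gamma_S\big(\{\theta\in\Theta_S:\|\theta-\theta^*\|^2\le\epsilon^2\}\big)}{\Gamma_{S^*}\big(\{\theta\in\Theta_{S^*}:D_2(P_{\theta^*}\|P_\theta)\le C_3|S^*|\log p\}\big)}\le\exp\big(C_5\epsilon^2+C_2(|S|+|S^*|)\log p\big),$$ where the denominator is positive. 2. The empirical Bayes posterior satisfies $$P_{\theta^*}\,\Pi_{\widehat\lambda}\big(\|\theta-\theta^*\|^2>M|S^*|\log p\,\big|\,Y\big)\le 4\exp\big(-C'|S^*|\log p\big).$$ -/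

import Mathlib

open MeasureTheory ProbabilityTheory
open scoped ENNReal

namespace EmpiricalBayes

section General

/-! Conditions for a general model `P`, loss `L`, subspaces `T Z`, and prior decomposition
`Π_l = ∑ Z, ν l Z • Γ Z`, `l ∈ Λ`.  The rate function is `rate Z = ε(Z) ^ 2`. -/

/-- The Rényi divergence `(ρ - 1)⁻¹ log ∫ (dP/dQ)^(ρ-1) dP` of order `ρ > 1`
(infinite if `P` is not absolutely continuous with respect to `Q`). -/
noncomputable def renyiDiv {X : Type*} [MeasurableSpace X] (ρ : ℝ) (P Q : Measure X) : EReal :=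
  open Classical in
  if P ≪ Q then
    (((ρ - 1)⁻¹ : ℝ) : EReal) * ENNReal.log (∫⁻ x, (P.rnDeriv Q x) ^ (ρ - 1) ∂P)
  else ⊤

/-- Testing condition: one test `φ` has small type-I error at `θstar` and, for every `r = ε ^ 2` at
least `rate Zstar` and every structure `Z`, small type-II error on the part of `T Z` at loss `≥ r`
from `θstar`. -/
def TestingCondition {X Θ I : Type*} [MeasurableSpace X] (P : Θ → Measure X) (L : Θ → Θ → ℝ)
    (T : I → Set Θ) (rate : I → ℝ) (θstar : Θ) (Zstar : I) (C C₁ C₂ : ℝ) : Prop :=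
  ∃ φ : X → ℝ, Measurable φ ∧ (∀ x, φ x ∈ Set.Icc (0 : ℝ) 1) ∧
    ∫ x, φ x ∂(P θstar) ≤ Real.exp (-C₁ * rate Zstar) ∧
    ∀ r : ℝ, rate Zstar ≤ r → ∀ Z : I, ∀ θ ∈ T Z, r ≤ L θ θstar →
      ∫ x, (1 - φ x) ∂(P θ) ≤ Real.exp (-C * r + C₂ * (rate Z + rate Zstar))

/-- Complexity condition: for some `lstar ∈ Λ`, the effective weights
`γ Z = max_{l ∈ Λ} w l * ν l Z` satisfy
`∑ Z, γ Z δ Z / (w lstar * ν lstar Zstar * δ Zstar) * exp (2 C₂ rate Z) ≤ exp (C₄ rate Zstar)`. -/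
def SieveCondition {I : Type*} [Fintype I] (Λ : Set ℝ) (w : ℝ → ℝ) (ν : ℝ → I → ℝ)
    (rate δ : I → ℝ) (Zstar : I) (C₂ C₄ : ℝ) : Prop :=
  ∃ lstar ∈ Λ, ∃ γ : I → ℝ,
    (∀ Z, IsGreatest ((fun l => w l * ν l Z) '' Λ) (γ Z)) ∧
    0 < w lstar * ν lstar Zstar ∧
    ∑ Z, γ Z * δ Z / (w lstar * ν lstar Zstar * δ Zstar) * Real.exp (2 * C₂ * rate Z)
      ≤ Real.exp (C₄ * rate Zstar)

/-- Prior mass ratio condition. -/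
def PriorMassCondition {X Θ I : Type*} [MeasurableSpace X] [MeasurableSpace Θ]
    (P : Θ → Measure X) (L : Θ → Θ → ℝ) (T : I → Set Θ) (Γ : I → Measure Θ)
    (rate δ : I → ℝ) (θstar : Θ) (Zstar : I) (ρ C₂ C₃ C₅ : ℝ) : Prop :=
  0 < (Γ Zstar).real
      {θ | θ ∈ T Zstar ∧ renyiDiv ρ (P θstar) (P θ) ≤ ((C₃ * rate Zstar : ℝ) : EReal)} ∧
  ∀ r : ℝ, rate Zstar ≤ r → ∀ Z : I,
    (Γ Z).real {θ | θ ∈ T Z ∧ L θ θstar ≤ r} /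
      (Γ Zstar).real
        {θ | θ ∈ T Zstar ∧ renyiDiv ρ (P θstar) (P θ) ≤ ((C₃ * rate Zstar : ℝ) : EReal)}
      ≤ δ Z / δ Zstar * Real.exp (C₅ * r + C₂ * (rate Z + rate Zstar))

end General

section SpikeAndSlab

/-- `‖θ - θ'‖ ^ 2` for the Euclidean norm on `ℝ^p`. -/
def sqLoss {p : ℕ} (θ θ' : Fin p → ℝ) : ℝ := ∑ j, (θ j - θ' j) ^ 2

/-- The Gaussian sequence model `N(θ, I_p)`. -/
noncomputable def seqModel {p : ℕ} (θ : Fin p → ℝ) : Measure (Fin p → ℝ) :=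
  Measure.pi fun j => gaussianReal (θ j) 1

/-- The density of `N(θ, I_p)` at `y`. -/
noncomputable def likelihood {p : ℕ} (y θ : Fin p → ℝ) : ℝ≥0∞ := ∏ j, gaussianPDF (θ j) 1 (y j)

/-- The vectors supported on `S`. -/
def supportedOn {p : ℕ} (S : Finset (Fin p)) : Set (Fin p → ℝ) := {θ | ∀ j, j ∉ S → θ j = 0}

/-- The Laplace distribution with density `(τ / 2) exp (-τ |x|)`. -/
noncomputable def laplace (τ : ℝ) : Measure ℝ :=
  volume.withDensity fun x => ENNReal.ofReal (τ / 2 * Real.exp (-τ * |x|))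

/-- The spike-and-slab prior `⊗_j ((1 - l) δ₀ + l G)` with Laplace slab `G`. -/
noncomputable def prior (p : ℕ) (τ l : ℝ) : Measure (Fin p → ℝ) :=
  Measure.pi fun _ =>
    ENNReal.ofReal (1 - l) • Measure.dirac (0 : ℝ) + ENNReal.ofReal l • laplace τ

/-- The component `(⊗_{j ∉ S} δ₀) ⊗ (⊗_{j ∈ S} G)` of the spike-and-slab prior. -/
noncomputable def component {p : ℕ} (τ : ℝ) (S : Finset (Fin p)) : Measure (Fin p → ℝ) :=
  Measure.pi fun j => if j ∈ S then laplace τ else Measure.dirac (0 : ℝ)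

/-- The prior probability of the component `S`. -/
def componentWeight {p : ℕ} (l : ℝ) (S : Finset (Fin p)) : ℝ :=
  (1 - l) ^ (p - S.card) * l ^ S.card

/-- The Beta-type weight function `l^(α-1) (1-l)^(β-1)`. -/
noncomputable def betaWeight (α β l : ℝ) : ℝ := l ^ (α - 1) * (1 - l) ^ (β - 1)

/-- The marginal likelihood `∫ p(y|θ) dΠ_l(θ)`. -/
noncomputable def marginal {p : ℕ} (τ l : ℝ) (y : Fin p → ℝ) : ℝ≥0∞ :=
  ∫⁻ θ, likelihood y θ ∂(prior p τ l)

/-- The posterior distribution `Π_l(· | y)`, i.e. `B ↦ ∫_B p(y|θ) dΠ_l(θ) / ∫ p(y|θ) dΠ_l(θ)`. -/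
noncomputable def posterior {p : ℕ} (τ l : ℝ) (y : Fin p → ℝ) : Measure (Fin p → ℝ) :=
  (marginal τ l y)⁻¹ • (prior p τ l).withDensity (likelihood y)

/-- `lhat` selects, for each observation, a maximiser over `[0, 1]` of
`log (w(l) ∫ p(y|θ) dΠ_l(θ))`, with the convention `log 0 = -∞`. -/
def IsEmpiricalBayesSelector {p : ℕ} (τ α β : ℝ) (lhat : (Fin p → ℝ) → ℝ) : Prop :=
  ∀ y, lhat y ∈ Set.Icc (0 : ℝ) 1 ∧
    IsMaxOn (fun l => ENNReal.log (ENNReal.ofReal (betaWeight α β l) * marginal τ l y))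
      (Set.Icc (0 : ℝ) 1) (lhat y)

/-- The squared rate `|S| log p`. -/
noncomputable def sparseRate {p : ℕ} (S : Finset (Fin p)) : ℝ := (S.card : ℝ) * Real.log p

end SpikeAndSlab

end EmpiricalBayes

namespace EmpiricalBayes

/-! ### Product measures: integrals and densities factor over coordinates. -/

section Product

/-! Write `r = |S*| log p`. Everything reduces to one-dimensional Gaussian and Laplace integrals,
combined over coordinates.

Testing: reject when `‖y - θ*‖²` restricted to some `S ∪ S*` exceeds `12 (|S| + |S*|) log p`. A
chi-square Chernoff bound and a union over `S` give the type-I error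
(`seqModel_rejectionRegion_le`). Integrating `exp (-‖y - θ*‖² / 2)` over the same coordinates gives
the type-II error `exp (-‖θ - θ*‖² / 4)` up to `exp (6 (|S| + |S*|) log p)`
(`seqModel_rejectionRegion_compl_le`).

Prior mass: Laplace tails change by a bounded factor under bounded shifts, and a Gaussian penalty
pays for larger ones. Hence `∫ exp (-‖θ - θ*‖² / 16) dΓ_S` is at most `slabConst τ ^ |S*|` times the
`Γ_{S*}`-mass of a ball around `θ*`, for every `S` (`lintegral_exp_neg_sqLoss_component_le`).

Complexity: `w(λ) ν_λ(S)` is `(λ / (1 - λ)) ^ |S|` times a factor free of `S`. Its maximiser has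
odds at most `p ^ (-(C₂' - 2))`, so the weights sum like a geometric series, while an oracle `λ*`
has odds at least `p ^ (-(C₁' + 1))` (`sieveCondition_betaWeight`).

Contraction: maximality of the selected `λ` bounds its weighted evidence below by that of `λ*`, and
the numerator is bounded by the maxima `γ(S)`. This is pointwise in `y`, so the data dependence of
`λ` disappears (`posterior_le_div`). The evidence is controlled by Cauchy–Schwarz and a chi-square
moment. The type-II exponent `1/4` splits as `3/16 + 1/16`: the first part beats all constants when
`M` is large, the second is the weight in the prior mass estimate, so no slicing into shells is
needed (`lintegral_posterior_le`). -/

theorem lintegral_fin_prod_eq_prod {n : ℕ} {μ : Fin n → Measure ℝ} [∀ i, SigmaFinite (μ i)]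
    {f : Fin n → ℝ → ℝ≥0∞} (hf : ∀ i, Measurable (f i)) :
    ∫⁻ x : Fin n → ℝ, ∏ i, f i (x i) ∂(Measure.pi μ) = ∏ i, ∫⁻ x, f i x ∂(μ i) := by
  induction n with
  | zero => simp
  | succ n ih =>
    calc
      _ = ∫⁻ x : ℝ × (Fin n → ℝ), f 0 x.1 * ∏ i : Fin n, f (Fin.succ i) (x.2 i)
            ∂((μ 0).prod (Measure.pi (fun i ↦ μ i.succ))) := by
          rw [← ((measurePreserving_piFinSuccAbove μ 0).symm).lintegral_comp (by fun_prop)]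
          refine lintegral_congr fun x => ?_
          simp [MeasurableEquiv.piFinSuccAbove_symm_apply, Fin.prod_univ_succ]
      _ = (∫⁻ x, f 0 x ∂μ 0) * ∏ i : Fin n, ∫⁻ x, f (Fin.succ i) x ∂(μ i.succ) := by
          rw [← ih fun i => hf i.succ, ← lintegral_prod_mul (hf 0).aemeasurable]
          exact (Finset.measurable_prod _ fun i _ => (hf _).comp (measurable_pi_apply i)).aemeasurable
      _ = ∏ i, ∫⁻ x, f i x ∂(μ i) := by rw [Fin.prod_univ_succ]

theorem pi_withDensity_eq {n : ℕ} {μ : Fin n → Measure ℝ} [∀ i, SigmaFinite (μ i)]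
    {f : Fin n → ℝ → ℝ≥0∞} (hf : ∀ i, Measurable (f i))
    [∀ i, SigmaFinite ((μ i).withDensity (f i))] :
    Measure.pi (fun i => (μ i).withDensity (f i)) =
      (Measure.pi μ).withDensity fun x => ∏ i, f i (x i) := by
  refine Measure.pi_eq fun s hs => ?_
  have key : ∀ x : Fin n → ℝ, (Set.univ.pi s).indicator (fun x => ∏ i, f i (x i)) x =
      ∏ i, (s i).indicator (f i) (x i) := by
    intro x
    by_cases hx : x ∈ Set.univ.pi s
    · rw [Set.indicator_of_mem hx]
      exact Finset.prod_congr rfl fun i _ => (Set.indicator_of_mem (hx i trivial) _).symm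
    · rw [Set.indicator_of_notMem hx]
      obtain ⟨i, hi⟩ : ∃ i, x i ∉ s i := by simpa using hx
      exact (Finset.prod_eq_zero (Finset.mem_univ i) (Set.indicator_of_notMem hi _)).symm
  rw [withDensity_apply _ (MeasurableSet.univ_pi hs),
    ← lintegral_indicator (MeasurableSet.univ_pi hs), lintegral_congr key,
    lintegral_fin_prod_eq_prod fun i => (hf i).indicator (hs i)]
  exact Finset.prod_congr rfl fun i _ => by
    rw [withDensity_apply _ (hs i), lintegral_indicator (hs i)]

end Product

/-! ### One-dimensional Gaussian identities. -/

section Gaussian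

theorem gaussianPDF_one_mul_exp_quarter (t x : ℝ) :
    gaussianPDF t 1 x * ENNReal.ofReal (Real.exp ((x - t) ^ 2 / 4)) =
      ENNReal.ofReal √2 * gaussianPDF t 2 x := by
  rw [gaussianPDF, gaussianPDF, ← ENNReal.ofReal_mul (gaussianPDFReal_nonneg _ _ _),
    ← ENNReal.ofReal_mul (by positivity)]
  congr 1
  simp only [gaussianPDFReal, NNReal.coe_one, NNReal.coe_ofNat]
  rw [mul_assoc, ← Real.exp_add, ← mul_assoc]
  congr 1
  · rw [mul_one, Real.sqrt_mul (by positivity) 2]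
    field_simp
  · congr 1; ring

/-- Completing the square; the leftover `(t - s)² / 4` is the source of the testing constant `1/4`.
-/
theorem gaussianPDF_one_mul_exp_neg_half (s t x : ℝ) :
    gaussianPDF t 1 x * ENNReal.ofReal (Real.exp (-(x - s) ^ 2 / 2)) =
      ENNReal.ofReal ((√2)⁻¹ * Real.exp (-(t - s) ^ 2 / 4)) * gaussianPDF ((t + s) / 2) 2⁻¹ x := by
  rw [gaussianPDF, gaussianPDF, ← ENNReal.ofReal_mul (gaussianPDFReal_nonneg _ _ _),
    ← ENNReal.ofReal_mul (by positivity)]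
  congr 1
  simp only [gaussianPDFReal, NNReal.coe_one, NNReal.coe_inv, NNReal.coe_ofNat]
  rw [mul_assoc, ← Real.exp_add, mul_mul_mul_comm, ← Real.exp_add]
  congr 1
  · rw [mul_one, Real.sqrt_mul (by positivity) 2⁻¹, Real.sqrt_inv]
    field_simp
  · congr 1; ring

/-- The chi-square integrand is again a Gaussian density, with mean reflected to `2t - s`, so its
integral is explicit. -/
theorem gaussianPDF_sq_div (s t x : ℝ) :
    gaussianPDF t 1 x * (gaussianPDF t 1 x * (gaussianPDF s 1 x)⁻¹) =
      ENNReal.ofReal (Real.exp ((s - t) ^ 2)) * gaussianPDF (2 * t - s) 1 x := by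
  have hs := gaussianPDFReal_pos s 1 x one_ne_zero
  have ht := gaussianPDFReal_nonneg t 1 x
  rw [gaussianPDF, gaussianPDF, gaussianPDF, ← ENNReal.ofReal_inv_of_pos hs,
    ← ENNReal.ofReal_mul ht, ← ENNReal.ofReal_mul ht, ← ENNReal.ofReal_mul (by positivity)]
  congr 1
  rw [← mul_assoc, mul_inv_eq_iff_eq_mul₀ hs.ne']
  simp only [gaussianPDFReal, NNReal.coe_one, mul_one]
  rw [mul_mul_mul_comm, ← Real.exp_add]
  have : ∀ a b c d : ℝ, Real.exp a * (b * Real.exp c) * (b * Real.exp d) =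
      b * b * Real.exp (a + c + d) := by
    intro a b c d; rw [Real.exp_add, Real.exp_add]; ring
  rw [this]
  congr 2; ring

theorem lintegral_exp_quarter_gaussianReal (t : ℝ) :
    ∫⁻ x, ENNReal.ofReal (Real.exp ((x - t) ^ 2 / 4)) ∂(gaussianReal t 1) =
      ENNReal.ofReal √2 := by
  rw [gaussianReal_of_var_ne_zero _ one_ne_zero,
    lintegral_withDensity_eq_lintegral_mul _ (measurable_gaussianPDF _ _) (by fun_prop)]
  simp only [Pi.mul_apply, gaussianPDF_one_mul_exp_quarter]
  rw [lintegral_const_mul _ (measurable_gaussianPDF _ _),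
    lintegral_gaussianPDF_eq_one _ two_ne_zero, mul_one]

theorem lintegral_exp_neg_half_gaussianReal_le (s t : ℝ) :
    ∫⁻ x, ENNReal.ofReal (Real.exp (-(x - s) ^ 2 / 2)) ∂(gaussianReal t 1) ≤
      ENNReal.ofReal (Real.exp (-(t - s) ^ 2 / 4)) := by
  rw [gaussianReal_of_var_ne_zero _ one_ne_zero,
    lintegral_withDensity_eq_lintegral_mul _ (measurable_gaussianPDF _ _) (by fun_prop)]
  simp only [Pi.mul_apply, gaussianPDF_one_mul_exp_neg_half]
  rw [lintegral_const_mul _ (measurable_gaussianPDF _ _),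
    lintegral_gaussianPDF_eq_one _ (by norm_num), mul_one]
  refine ENNReal.ofReal_le_ofReal (mul_le_of_le_one_left (Real.exp_nonneg _) ?_)
  exact inv_le_one_of_one_le₀ (Real.one_le_sqrt.2 one_le_two)

end Gaussian

/-! ### Likelihood and order-2 Rényi divergence in the sequence model. -/

section SequenceModel

variable {p : ℕ}

instance isProbabilityMeasure_seqModel (θ : Fin p → ℝ) : IsProbabilityMeasure (seqModel θ) := by
  unfold seqModel; infer_instance

theorem measurable_likelihood_uncurry :
    Measurable fun z : (Fin p → ℝ) × (Fin p → ℝ) => likelihood z.1 z.2 := by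
  unfold likelihood
  refine Finset.measurable_prod _ fun j _ => ?_
  exact measurable_uncurry_gaussianPDF.comp (by fun_prop :
    Measurable fun z : (Fin p → ℝ) × (Fin p → ℝ) => (z.2 j, (1 : NNReal), z.1 j))

theorem measurable_likelihood_left (θ : Fin p → ℝ) : Measurable fun y => likelihood y θ :=
  Finset.measurable_prod _ fun j _ => (measurable_gaussianPDF (θ j) 1).comp (measurable_pi_apply j)

theorem measurable_likelihood_right (y : Fin p → ℝ) : Measurable (likelihood y) := by
  unfold likelihood
  refine Finset.measurable_prod _ fun j _ => ?_
  exact measurable_uncurry_gaussianPDF.comp (by fun_prop :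
    Measurable fun θ : Fin p → ℝ => (θ j, (1 : NNReal), y j))

theorem likelihood_ne_zero (y θ : Fin p → ℝ) : likelihood y θ ≠ 0 :=
  Finset.prod_ne_zero_iff.2 fun _ _ => (gaussianPDF_pos _ one_ne_zero _).ne'

theorem likelihood_ne_top (y θ : Fin p → ℝ) : likelihood y θ ≠ ∞ :=
  ENNReal.prod_ne_top fun _ _ => gaussianPDF_ne_top

theorem measurable_sqLoss (θ' : Fin p → ℝ) : Measurable fun θ => sqLoss θ θ' := by
  unfold sqLoss; fun_prop

theorem seqModel_eq_withDensity (θ : Fin p → ℝ) :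
    seqModel θ = volume.withDensity fun y => likelihood y θ := by
  have h : ∀ j : Fin p, gaussianReal (θ j) 1 = volume.withDensity (gaussianPDF (θ j) 1) :=
    fun j => gaussianReal_of_var_ne_zero _ one_ne_zero
  have : ∀ j : Fin p, SigmaFinite ((volume : Measure ℝ).withDensity (gaussianPDF (θ j) 1)) :=
    fun j => by rw [← h j]; infer_instance
  unfold seqModel likelihood
  simp_rw [h]
  exact pi_withDensity_eq fun j => measurable_gaussianPDF _ _

theorem lintegral_likelihood (θ : Fin p → ℝ) : ∫⁻ y, likelihood y θ = 1 := by
  have := measure_univ (μ := seqModel θ)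
  rwa [seqModel_eq_withDensity, withDensity_apply _ MeasurableSet.univ, setLIntegral_univ] at this

theorem likelihood_sq_div (y θ θ' : Fin p → ℝ) :
    likelihood y θ' * (likelihood y θ' * (likelihood y θ)⁻¹) =
      ENNReal.ofReal (Real.exp (sqLoss θ θ')) * likelihood y (fun j => 2 * θ' j - θ j) := by
  unfold likelihood sqLoss
  rw [Real.exp_sum, ENNReal.ofReal_prod_of_nonneg fun _ _ => Real.exp_nonneg _,
    ENNReal.prod_inv_distrib, ← Finset.prod_mul_distrib, ← Finset.prod_mul_distrib,
    ← Finset.prod_mul_distrib]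
  · exact Finset.prod_congr rfl fun j _ => gaussianPDF_sq_div _ _ _
  · intro i _ j _ _
    exact Or.inl (gaussianPDF_pos _ one_ne_zero _).ne'

theorem lintegral_likelihood_sq_div (θ θ' : Fin p → ℝ) :
    ∫⁻ y, likelihood y θ' * (likelihood y θ' * (likelihood y θ)⁻¹) =
      ENNReal.ofReal (Real.exp (sqLoss θ θ')) := by
  simp only [likelihood_sq_div]
  rw [lintegral_const_mul _ (measurable_likelihood_left _), lintegral_likelihood, mul_one]

theorem renyiDiv_two_le_sqLoss (θ θ' : Fin p → ℝ) :
    renyiDiv 2 (seqModel θ') (seqModel θ) ≤ ((sqLoss θ θ' : ℝ) : EReal) := by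
  have hm : Measurable fun y => likelihood y θ' * (likelihood y θ)⁻¹ :=
    (measurable_likelihood_left _).mul (measurable_likelihood_left _).inv
  have hd : seqModel θ' =
      (seqModel θ).withDensity fun y => likelihood y θ' * (likelihood y θ)⁻¹ := by
    rw [seqModel_eq_withDensity θ, ← withDensity_mul _ (measurable_likelihood_left _) hm,
      seqModel_eq_withDensity θ']
    congr 1
    funext y
    rw [Pi.mul_apply, mul_left_comm, ENNReal.mul_inv_cancel (likelihood_ne_zero _ _)
      (likelihood_ne_top _ _), mul_one]
  have hac : seqModel θ' ≪ seqModel θ := by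
    rw [hd]; exact withDensity_absolutelyContinuous _ _
  have hr : (seqModel θ').rnDeriv (seqModel θ) =ᵐ[seqModel θ']
      fun y => likelihood y θ' * (likelihood y θ)⁻¹ := by
    refine hac.ae_le ?_
    have h := Measure.rnDeriv_withDensity (seqModel θ) hm
    rwa [← hd] at h
  have hi : ∫⁻ x, ((seqModel θ').rnDeriv (seqModel θ) x) ^ ((2 : ℝ) - 1) ∂(seqModel θ') =
      ENNReal.ofReal (Real.exp (sqLoss θ θ')) := by
    rw [← lintegral_likelihood_sq_div]
    calc _ = ∫⁻ y, likelihood y θ' * (likelihood y θ)⁻¹ ∂(seqModel θ') := by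
          refine lintegral_congr_ae (hr.mono fun y hy => ?_)
          simp only [hy]
          norm_num
      _ = _ := by
          rw [seqModel_eq_withDensity,
            lintegral_withDensity_eq_lintegral_mul _ (measurable_likelihood_left _) hm]
          rfl
  rw [renyiDiv, if_pos hac, hi, ENNReal.log_ofReal_of_pos (Real.exp_pos _), Real.log_exp]
  norm_num

end SequenceModel

/-! ### The Laplace slab under a Gaussian weight. -/

section Laplace

variable {τ : ℝ}

theorem isProbabilityMeasure_laplace (hτ : 0 < τ) : IsProbabilityMeasure (laplace τ) := by
  constructor
  have hhalf : ENNReal.ofReal (1 / 2) + ENNReal.ofReal (1 / 2) = 1 := by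
    rw [← ENNReal.ofReal_add (by norm_num) (by norm_num)]; norm_num
  have hneg : ∫⁻ x in Set.Iic 0, ENNReal.ofReal (τ / 2 * Real.exp (-τ * |x|)) =
      ENNReal.ofReal (1 / 2) := by
    rw [setLIntegral_congr_fun (g := fun x => ENNReal.ofReal (τ / 2 * Real.exp (τ * x)))
      measurableSet_Iic fun x hx => by
        simp only [abs_of_nonpos (Set.mem_Iic.1 hx), neg_mul_neg],
      ← ofReal_integral_eq_lintegral_ofReal ((integrableOn_exp_mul_Iic hτ 0).const_mul _)
        (ae_of_all _ fun x => by positivity), integral_const_mul, integral_exp_mul_Iic hτ]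
    congr 1; simp; field_simp
  have hpos : ∫⁻ x in Set.Ioi 0, ENNReal.ofReal (τ / 2 * Real.exp (-τ * |x|)) =
      ENNReal.ofReal (1 / 2) := by
    rw [setLIntegral_congr_fun (g := fun x => ENNReal.ofReal (τ / 2 * Real.exp (-τ * x)))
      measurableSet_Ioi fun x hx => by simp only [abs_of_pos (Set.mem_Ioi.1 hx)],
      ← ofReal_integral_eq_lintegral_ofReal
        ((integrableOn_exp_mul_Ioi (neg_lt_zero.2 hτ) 0).const_mul _)
        (ae_of_all _ fun x => by positivity), integral_const_mul,
      integral_exp_mul_Ioi (neg_lt_zero.2 hτ)]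
    congr 1; simp; field_simp
  rw [laplace, withDensity_apply _ MeasurableSet.univ, setLIntegral_univ,
    ← lintegral_add_compl _ measurableSet_Iic, Set.compl_Iic, hneg, hpos, hhalf]

/-- Compares Gaussian-weighted Laplace mass with the Laplace mass of a unit neighbourhood. -/
noncomputable def slabConst (τ : ℝ) : ℝ :=
  Real.exp (8 * τ ^ 2) * (1 + τ / 2 * √(2 * Real.pi * 16)) / (τ * Real.exp (-τ))

theorem slabConst_pos (hτ : 0 < τ) : 0 < slabConst τ := by
  unfold slabConst; positivity

theorem le_laplace_Icc (hτ : 0 < τ) (t : ℝ) :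
    ENNReal.ofReal (τ * Real.exp (-τ) * Real.exp (-τ * |t|)) ≤
      laplace τ (Set.Icc (t - 1) (t + 1)) := by
  rw [laplace, withDensity_apply _ measurableSet_Icc]
  calc _ = ∫⁻ _ in Set.Icc (t - 1) (t + 1),
        ENNReal.ofReal (τ / 2 * Real.exp (-τ * (|t| + 1))) := by
        rw [setLIntegral_const, Real.volume_Icc, ← ENNReal.ofReal_mul (by positivity)]
        congr 1
        rw [show -τ * (|t| + 1) = -τ + -τ * |t| by ring, Real.exp_add]; ring
    _ ≤ _ := by
        refine setLIntegral_mono (by fun_prop) fun x hx => ENNReal.ofReal_le_ofReal ?_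
        have h1 : |x| ≤ |t| + 1 := by
          have h2 : |x - t| ≤ 1 := abs_le.2 ⟨by linarith [hx.1], by linarith [hx.2]⟩
          linarith [abs_sub_abs_le_abs_sub x t]
        gcongr ?_ * Real.exp ?_
        nlinarith

/-- Half of the quadratic pays for moving the Laplace factor from `x` to `t`, by `τ|x - t| ≤ (x -
t)² / 32 + 8τ²`; the other half is an unnormalised `N(t, 16)` density. -/
theorem lintegral_exp_laplace_le_exp (hτ : 0 < τ) (t : ℝ) :
    ∫⁻ x, ENNReal.ofReal (Real.exp (-(x - t) ^ 2 / 16)) ∂(laplace τ) ≤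
      ENNReal.ofReal (Real.exp (8 * τ ^ 2) * (1 + τ / 2 * √(2 * Real.pi * 16)) *
        Real.exp (-τ * |t|)) := by
  rw [laplace, lintegral_withDensity_eq_lintegral_mul _ (by fun_prop) (by fun_prop)]
  calc _ ≤ ∫⁻ x, ENNReal.ofReal (Real.exp (8 * τ ^ 2) * (1 + τ / 2 * √(2 * Real.pi * 16)) *
        Real.exp (-τ * |t|)) * gaussianPDF t 16 x := by
        refine lintegral_mono fun x => ?_
        rw [Pi.mul_apply, gaussianPDF, ← ENNReal.ofReal_mul (by positivity),
          ← ENNReal.ofReal_mul (by positivity)]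
        refine ENNReal.ofReal_le_ofReal ?_
        simp only [gaussianPDFReal, NNReal.coe_ofNat]
        have hc : 0 < √(2 * Real.pi * 16) := by positivity
        have he : -τ * |x| + -(x - t) ^ 2 / 16 ≤
            8 * τ ^ 2 + -τ * |t| + -(x - t) ^ 2 / (2 * 16) := by
          have h1 : |t| - |x| ≤ |x - t| := by
            rw [abs_sub_comm]; exact abs_sub_abs_le_abs_sub t x
          have h2 := mul_le_mul_of_nonneg_left h1 hτ.le
          nlinarith [sq_nonneg (|x - t| - 16 * τ), sq_abs (x - t)]
        calc _ = τ / 2 * Real.exp (-τ * |x| + -(x - t) ^ 2 / 16) := by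
              rw [Real.exp_add]; ring
          _ ≤ τ / 2 * Real.exp (8 * τ ^ 2 + -τ * |t| + -(x - t) ^ 2 / (2 * 16)) := by gcongr
          _ = (τ / 2 * √(2 * Real.pi * 16)) * (Real.exp (8 * τ ^ 2) * Real.exp (-τ * |t|) *
                ((√(2 * Real.pi * 16))⁻¹ * Real.exp (-(x - t) ^ 2 / (2 * 16)))) := by
              rw [Real.exp_add, Real.exp_add]; field_simp
          -- The extra `1` is slack here; it lets the same constant cover the spike in
          -- `ofReal_exp_sq_le`.
          _ ≤ (1 + τ / 2 * √(2 * Real.pi * 16)) * (Real.exp (8 * τ ^ 2) * Real.exp (-τ * |t|) *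
                ((√(2 * Real.pi * 16))⁻¹ * Real.exp (-(x - t) ^ 2 / (2 * 16)))) := by
              gcongr; linarith
          _ = _ := by ring
    _ = _ := by
        rw [lintegral_const_mul _ (measurable_gaussianPDF _ _),
          lintegral_gaussianPDF_eq_one _ (by norm_num), mul_one]

theorem ofReal_exp_le_slabConst_mul (hτ : 0 < τ) (t : ℝ) :
    ENNReal.ofReal (Real.exp (8 * τ ^ 2) * (1 + τ / 2 * √(2 * Real.pi * 16)) *
        Real.exp (-τ * |t|)) ≤
      ENNReal.ofReal (slabConst τ) * laplace τ (Set.Icc (t - 1) (t + 1)) := by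
  refine le_trans (le_of_eq ?_) (mul_le_mul_right (le_laplace_Icc hτ t) _)
  rw [← ENNReal.ofReal_mul (slabConst_pos hτ).le]
  congr 1
  unfold slabConst
  field_simp

theorem lintegral_exp_laplace_le (hτ : 0 < τ) (t : ℝ) :
    ∫⁻ x, ENNReal.ofReal (Real.exp (-(x - t) ^ 2 / 16)) ∂(laplace τ) ≤
      ENNReal.ofReal (slabConst τ) * laplace τ (Set.Icc (t - 1) (t + 1)) :=
  (lintegral_exp_laplace_le_exp hτ t).trans (ofReal_exp_le_slabConst_mul hτ t)

/-- The spike counterpart: setting a coordinate with true value `t` to zero costs `t² / 16`, which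
exceeds the Laplace cost `τ|t|` up to a constant. -/
theorem ofReal_exp_sq_le (hτ : 0 < τ) (t : ℝ) :
    ENNReal.ofReal (Real.exp (-(0 - t) ^ 2 / 16)) ≤
      ENNReal.ofReal (slabConst τ) * laplace τ (Set.Icc (t - 1) (t + 1)) := by
  refine (ENNReal.ofReal_le_ofReal ?_).trans (ofReal_exp_le_slabConst_mul hτ t)
  calc Real.exp (-(0 - t) ^ 2 / 16) ≤ Real.exp (8 * τ ^ 2 + -τ * |t|) := by
        gcongr
        nlinarith [sq_nonneg (|t| - 8 * τ), sq_abs t, sq_nonneg τ]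
    _ = Real.exp (8 * τ ^ 2) * 1 * Real.exp (-τ * |t|) := by rw [Real.exp_add, mul_one]
    _ ≤ _ := by
        gcongr
        have : 0 ≤ τ / 2 * √(2 * Real.pi * 16) := by positivity
        linarith

end Laplace

/-! ### Mixture decomposition and prior mass comparison. -/

section Prior

variable {τ : ℝ} {p : ℕ}

theorem isProbabilityMeasure_slab_or_dirac (hτ : 0 < τ) (S : Finset (Fin p)) (j : Fin p) :
    IsProbabilityMeasure (if j ∈ S then laplace τ else Measure.dirac (0 : ℝ)) := by
  split_ifs
  · exact isProbabilityMeasure_laplace hτ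
  · infer_instance

theorem isProbabilityMeasure_component (hτ : 0 < τ) (S : Finset (Fin p)) :
    IsProbabilityMeasure (component τ S) := by
  have := isProbabilityMeasure_slab_or_dirac hτ S
  unfold component; infer_instance

theorem componentWeight_nonneg {l : ℝ} (hl : l ∈ Set.Icc (0 : ℝ) 1) (S : Finset (Fin p)) :
    0 ≤ componentWeight l S :=
  mul_nonneg (pow_nonneg (by linarith [hl.2]) _) (pow_nonneg hl.1 _)

theorem prior_eq_sum (hτ : 0 < τ) {l : ℝ} (hl : l ∈ Set.Icc (0 : ℝ) 1) :
    prior p τ l =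
      ∑ S : Finset (Fin p), ENNReal.ofReal (componentWeight l S) • component τ S := by
  have := isProbabilityMeasure_laplace hτ
  have h1 : IsFiniteMeasure
      (ENNReal.ofReal (1 - l) • Measure.dirac (0 : ℝ) + ENNReal.ofReal l • laplace τ) := by
    have := Measure.smul_finite (Measure.dirac (0 : ℝ)) (ENNReal.ofReal_ne_top (r := 1 - l))
    have := Measure.smul_finite (laplace τ) (ENNReal.ofReal_ne_top (r := l))
    infer_instance
  refine Measure.pi_eq fun s hs => ?_
  simp only [Measure.finsetSum_apply, Measure.smul_apply, smul_eq_mul, Measure.add_apply]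
  -- With the slab as first summand, the subset in `Finset.prod_add` is the set of slab coordinates.
  simp_rw [add_comm (ENNReal.ofReal (1 - l) * _)]
  rw [Finset.prod_add, Finset.powerset_univ]
  refine Finset.sum_congr rfl fun S _ => ?_
  have := isProbabilityMeasure_slab_or_dirac hτ S
  rw [component, Measure.pi_pi, ← Finset.prod_mul_prod_compl S, Finset.prod_mul_distrib,
    Finset.prod_mul_distrib, Finset.prod_const, Finset.prod_const, ← Finset.compl_eq_univ_sdiff,
    Finset.card_compl, Fintype.card_fin, componentWeight,
    ENNReal.ofReal_mul (pow_nonneg (by linarith [hl.2]) _),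
    ENNReal.ofReal_pow (by linarith [hl.2]), ENNReal.ofReal_pow hl.1]
  rw [Finset.prod_congr rfl fun i (hi : i ∈ S) => by rw [if_pos hi],
    Finset.prod_congr rfl fun i (hi : i ∈ Sᶜ) => by rw [if_neg (Finset.mem_compl.1 hi)]]
  ring

theorem setLIntegral_prior (hτ : 0 < τ) {l : ℝ} (hl : l ∈ Set.Icc (0 : ℝ) 1)
    (f : (Fin p → ℝ) → ℝ≥0∞) {B : Set (Fin p → ℝ)} (hB : MeasurableSet B) :
    ∫⁻ θ in B, f θ ∂(prior p τ l) =
      ∑ S : Finset (Fin p),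
        ENNReal.ofReal (componentWeight l S) * ∫⁻ θ in B, f θ ∂(component τ S) := by
  simp_rw [← lintegral_indicator hB]
  rw [prior_eq_sum hτ hl, lintegral_finsetSum_measure]
  simp_rw [lintegral_smul_measure, smul_eq_mul]

theorem measurableSet_supportedOn (S : Finset (Fin p)) : MeasurableSet (supportedOn S) := by
  have : supportedOn S = ⋂ j, {θ : Fin p → ℝ | j ∉ S → θ j = 0} := by
    ext θ; simp [supportedOn]
  rw [this]
  refine MeasurableSet.iInter fun j => ?_
  by_cases hj : j ∈ S
  · simp [hj]
  · simpa [hj] using measurableSet_eq_fun (measurable_pi_apply j) measurable_const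

/-- Both sides factor once the ball is shrunk to a cube of half-width 1 on `Sstar`. On `Sstar` each
factor is handled by the slab or the spike estimate; off `Sstar` the left factor is at most 1 and
the right one equals 1. Hence the constant depends on `Sstar.card` only, not on `S`. -/
theorem lintegral_exp_neg_sqLoss_component_le (hτ : 0 < τ) (S Sstar : Finset (Fin p))
    {θstar : Fin p → ℝ} (hθ : θstar ∈ supportedOn Sstar) :
    ∫⁻ θ, ENNReal.ofReal (Real.exp (-(1 / 16) * sqLoss θ θstar)) ∂(component τ S) ≤
      ENNReal.ofReal (slabConst τ ^ Sstar.card) *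
        component τ Sstar {θ | θ ∈ supportedOn Sstar ∧ sqLoss θ θstar ≤ Sstar.card} := by
  have := isProbabilityMeasure_laplace hτ
  have := isProbabilityMeasure_slab_or_dirac hτ S
  have := isProbabilityMeasure_slab_or_dirac hτ Sstar
  set I : Fin p → Set ℝ :=
    fun j => if j ∈ Sstar then Set.Icc (θstar j - 1) (θstar j + 1) else {0} with hI
  have hsub : Set.univ.pi I ⊆
      {θ | θ ∈ supportedOn Sstar ∧ sqLoss θ θstar ≤ Sstar.card} := by
    intro θ hθI
    have h0 : θ ∈ supportedOn Sstar := fun j hj => by simpa [hI, hj] using hθI j trivial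
    refine ⟨h0, ?_⟩
    calc sqLoss θ θstar ≤ ∑ j, if j ∈ Sstar then (1 : ℝ) else 0 := by
          refine Finset.sum_le_sum fun j _ => ?_
          split_ifs with hj
          · have h1 : θ j ∈ Set.Icc (θstar j - 1) (θstar j + 1) := by
              simpa [hI, hj] using hθI j trivial
            nlinarith [h1.1, h1.2]
          · simp [h0 j hj, hθ j hj]
      _ = Sstar.card := by simp
  refine le_trans ?_ (mul_le_mul_right (measure_mono hsub) _)
  have hexp : ∀ θ : Fin p → ℝ, ENNReal.ofReal (Real.exp (-(1 / 16) * sqLoss θ θstar)) =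
      ∏ j, ENNReal.ofReal (Real.exp (-(θ j - θstar j) ^ 2 / 16)) := by
    intro θ
    rw [← ENNReal.ofReal_prod_of_nonneg fun _ _ => Real.exp_nonneg _, ← Real.exp_sum, sqLoss,
      Finset.mul_sum]
    congr 3; funext j; ring
  have hcard : ENNReal.ofReal (slabConst τ ^ Sstar.card) =
      ∏ j, if j ∈ Sstar then ENNReal.ofReal (slabConst τ) else 1 := by
    rw [ENNReal.ofReal_pow (slabConst_pos hτ).le]; simp
  simp_rw [hexp]
  rw [component, component, Measure.pi_pi,
    lintegral_fin_prod_eq_prod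
      (f := fun j x => ENNReal.ofReal (Real.exp (-(x - θstar j) ^ 2 / 16)))
      fun j => by fun_prop, hcard, ← Finset.prod_mul_distrib]
  refine Finset.prod_le_prod' fun j _ => ?_
  by_cases hs : j ∈ Sstar
  · simp only [hI, hs, if_true]
    split_ifs with hj
    · exact lintegral_exp_laplace_le hτ _
    · rw [lintegral_dirac]; exact ofReal_exp_sq_le hτ _
  · simp only [hI, hs, if_false, one_mul]
    rw [Measure.dirac_apply' _ (measurableSet_singleton 0), Set.indicator_of_mem (Set.mem_singleton _),
      Pi.one_apply]
    calc _ ≤ ∫⁻ _, 1 ∂(if j ∈ S then laplace τ else Measure.dirac (0 : ℝ)) := by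
          refine lintegral_mono fun x => ENNReal.ofReal_le_one.2 (Real.exp_le_one_iff.2 ?_)
          have := sq_nonneg (x - θstar j)
          linarith
      _ = 1 := by simp

theorem component_ball_pos (hτ : 0 < τ) (Sstar : Finset (Fin p))
    {θstar : Fin p → ℝ} (hθ : θstar ∈ supportedOn Sstar) :
    0 < component τ Sstar {θ | θ ∈ supportedOn Sstar ∧ sqLoss θ θstar ≤ Sstar.card} := by
  have := isProbabilityMeasure_component hτ Sstar
  have h := lintegral_exp_neg_sqLoss_component_le hτ Sstar Sstar hθ
  rw [pos_iff_ne_zero]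
  intro h0
  rw [h0, mul_zero, nonpos_iff_eq_zero, lintegral_eq_zero_iff
    (by have := measurable_sqLoss θstar; fun_prop)] at h
  obtain ⟨θ, hθ⟩ := h.exists
  simp at hθ
  exact absurd hθ (not_le.2 (Real.exp_pos _))

end Prior

/-! ### The test and its two error bounds. -/

section Testing

theorem measure_le_lintegral_of_one_le {X : Type*} [MeasurableSpace X] {μ : Measure X}
    {s : Set X} (hs : MeasurableSet s) {f : X → ℝ≥0∞} (h : ∀ x ∈ s, 1 ≤ f x) :
    μ s ≤ ∫⁻ x, f x ∂μ := by
  rw [← lintegral_indicator_one hs]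
  refine lintegral_mono fun x => ?_
  by_cases hx : x ∈ s
  · rw [Set.indicator_of_mem hx]; exact h x hx
  · rw [Set.indicator_of_notMem hx]; exact zero_le

variable {p : ℕ}

theorem log_natCast_ge (hp : 2 ≤ p) : (0.69 : ℝ) ≤ Real.log p := by
  have h1 : Real.log 2 ≤ Real.log p :=
    Real.log_le_log two_pos (by exact_mod_cast hp)
  linarith [Real.log_two_gt_d9]

/-- By the binomial theorem the sum is `(1 + e⁻ᵃ) ^ p ≤ (1 + 1/p) ^ p ≤ e`. -/
theorem sum_exp_neg_mul_card_le (hp : 2 ≤ p) {a : ℝ} (ha : Real.log p ≤ a) :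
    ∑ S : Finset (Fin p), Real.exp (-a * S.card) ≤ Real.exp 1 := by
  have hp0 : (0 : ℝ) < p := by positivity
  have h1 : ∑ S : Finset (Fin p), Real.exp (-a * S.card) = (Real.exp (-a) + 1) ^ p := by
    have := Fintype.sum_pow_mul_eq_add_pow (Fin p) (Real.exp (-a)) 1
    rw [Fintype.card_fin] at this
    rw [← this]
    refine Finset.sum_congr rfl fun S _ => ?_
    rw [one_pow, mul_one, ← Real.exp_nat_mul, mul_comm]
  have h2 : Real.exp (-a) ≤ (p : ℝ)⁻¹ := by
    rw [← Real.exp_log (inv_pos.2 hp0), Real.log_inv]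
    exact Real.exp_le_exp.2 (neg_le_neg ha)
  rw [h1]
  calc (Real.exp (-a) + 1) ^ p ≤ Real.exp ((p : ℝ)⁻¹) ^ p := by
        gcongr
        linarith [Real.add_one_le_exp ((p : ℝ)⁻¹)]
    _ = Real.exp 1 := by
        rw [← Real.exp_nat_mul, mul_inv_cancel₀ hp0.ne']

theorem lintegral_exp_sum_sq_seqModel (U : Finset (Fin p)) (c : ℝ) (θ s : Fin p → ℝ) :
    ∫⁻ y, ENNReal.ofReal (Real.exp (c * ∑ j ∈ U, (y j - s j) ^ 2)) ∂(seqModel θ) =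
      ∏ j ∈ U, ∫⁻ x, ENNReal.ofReal (Real.exp (c * (x - s j) ^ 2)) ∂(gaussianReal (θ j) 1) := by
  have h : ∀ y : Fin p → ℝ, ENNReal.ofReal (Real.exp (c * ∑ j ∈ U, (y j - s j) ^ 2)) =
      ∏ j, if j ∈ U then ENNReal.ofReal (Real.exp (c * (y j - s j) ^ 2)) else 1 := by
    intro y
    rw [Finset.mul_sum, Real.exp_sum, ENNReal.ofReal_prod_of_nonneg fun _ _ => Real.exp_nonneg _,
      Finset.prod_ite_mem, Finset.univ_inter]
  simp_rw [h]
  rw [seqModel, lintegral_fin_prod_eq_prod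
    (f := fun j x => if j ∈ U then ENNReal.ofReal (Real.exp (c * (x - s j) ^ 2)) else 1)
    fun j => by split_ifs <;> fun_prop]
  rw [← Finset.univ_inter U, ← Finset.prod_ite_mem, Finset.univ_inter]
  refine Finset.prod_congr rfl fun j _ => ?_
  split_ifs <;> simp

/-- The rejection region: on some sparse set of coordinates the observation is too far from the
true mean. -/
def rejectionRegion (θstar : Fin p → ℝ) (Sstar : Finset (Fin p)) : Set (Fin p → ℝ) :=
  ⋃ S : Finset (Fin p), {y | 12 * ((S.card + Sstar.card : ℝ) * Real.log p) <
    ∑ j ∈ S ∪ Sstar, (y j - θstar j) ^ 2}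

theorem measurableSet_excess (θstar : Fin p → ℝ) (U : Finset (Fin p)) (R : ℝ) :
    MeasurableSet {y : Fin p → ℝ | R < ∑ j ∈ U, (y j - θstar j) ^ 2} :=
  measurableSet_lt measurable_const (by fun_prop)

theorem measurableSet_rejectionRegion (θstar : Fin p → ℝ) (Sstar : Finset (Fin p)) :
    MeasurableSet (rejectionRegion θstar Sstar) :=
  MeasurableSet.iUnion fun _ => measurableSet_excess _ _ _

/-- Chernoff at exponent `1/4`: the threshold gains `12/4 = 3`, and each coordinate costs `√2 ≤ p ^
(1/2)`, leaving `3 - 1/2 = 5/2`. -/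
theorem seqModel_excess_le (hp : 2 ≤ p) (θstar : Fin p → ℝ) (S Sstar : Finset (Fin p)) :
    seqModel θstar {y | 12 * ((S.card + Sstar.card : ℝ) * Real.log p) <
        ∑ j ∈ S ∪ Sstar, (y j - θstar j) ^ 2} ≤
      ENNReal.ofReal (Real.exp (-(5 / 2) * ((S.card + Sstar.card : ℝ) * Real.log p))) := by
  set R := (S.card + Sstar.card : ℝ) * Real.log p with hR
  refine (measure_le_lintegral_of_one_le (measurableSet_excess _ _ _)
    (f := fun y => ENNReal.ofReal (Real.exp (-3 * R)) *
      ENNReal.ofReal (Real.exp (1 / 4 * ∑ j ∈ S ∪ Sstar, (y j - θstar j) ^ 2))) ?_).trans ?_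
  · intro y hy
    rw [← ENNReal.ofReal_mul (Real.exp_nonneg _), ← Real.exp_add]
    refine ENNReal.one_le_ofReal.2 (Real.one_le_exp ?_)
    have : 12 * R < ∑ j ∈ S ∪ Sstar, (y j - θstar j) ^ 2 := hy
    linarith
  · rw [lintegral_const_mul _ (by fun_prop), lintegral_exp_sum_sq_seqModel]
    have h1 : ∀ j, ∫⁻ x, ENNReal.ofReal (Real.exp (1 / 4 * (x - θstar j) ^ 2))
        ∂(gaussianReal (θstar j) 1) = ENNReal.ofReal √2 := by
      intro j
      rw [← lintegral_exp_quarter_gaussianReal (θstar j)]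
      congr 1; funext x; congr 2; ring
    simp_rw [h1]
    rw [Finset.prod_const, ← ENNReal.ofReal_pow (Real.sqrt_nonneg _),
      ← ENNReal.ofReal_mul (Real.exp_nonneg _)]
    refine ENNReal.ofReal_le_ofReal ?_
    have h2 : √2 ≤ Real.exp (1 / 2 * Real.log p) := by
      rw [Real.sqrt_eq_rpow, Real.rpow_def_of_pos two_pos, mul_comm]
      gcongr
      exact_mod_cast hp
    have h3 : ((S ∪ Sstar).card : ℝ) ≤ S.card + Sstar.card := by
      exact_mod_cast Finset.card_union_le S Sstar
    have hL := log_natCast_ge hp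
    calc _ ≤ Real.exp (-3 * R) * Real.exp (1 / 2 * Real.log p) ^ (S ∪ Sstar).card := by gcongr
      _ = Real.exp (-3 * R + (S ∪ Sstar).card * (1 / 2 * Real.log p)) := by
          rw [← Real.exp_nat_mul, ← Real.exp_add]
      _ ≤ _ := by
          gcongr
          have := mul_le_mul_of_nonneg_right h3 (by linarith : 0 ≤ Real.log p)
          rw [← hR] at this
          linarith

theorem seqModel_rejectionRegion_le (hp : 2 ≤ p) (θstar : Fin p → ℝ) {Sstar : Finset (Fin p)}
    (hS : Sstar.Nonempty) :
    seqModel θstar (rejectionRegion θstar Sstar) ≤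
      ENNReal.ofReal (Real.exp (-(Sstar.card * Real.log p))) := by
  have hL := log_natCast_ge hp
  refine (measure_iUnion_fintype_le _ _).trans
    ((Finset.sum_le_sum fun S _ => seqModel_excess_le hp θstar S Sstar).trans ?_)
  rw [← ENNReal.ofReal_sum_of_nonneg fun _ _ => Real.exp_nonneg _]
  refine ENNReal.ofReal_le_ofReal ?_
  have hs : (1 : ℝ) ≤ Sstar.card := by exact_mod_cast hS.card_pos
  calc _ = Real.exp (-(5 / 2) * (Sstar.card * Real.log p)) *
        ∑ S : Finset (Fin p), Real.exp (-(5 / 2 * Real.log p) * S.card) := by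
        rw [Finset.mul_sum]
        refine Finset.sum_congr rfl fun S _ => ?_
        rw [← Real.exp_add]; congr 1; ring
    _ ≤ Real.exp (-(5 / 2) * (Sstar.card * Real.log p)) * Real.exp 1 := by
        gcongr
        exact sum_exp_neg_mul_card_le hp (by linarith)
    _ ≤ _ := by
        rw [← Real.exp_add]
        gcongr
        -- The constant `e` of the union bound is absorbed because `|S*| ≥ 1` and `(3/2) · 0.69 >
        -- 1`.
        nlinarith

/-- Acceptance bounds the sum over `S ∪ Sstar` in particular, and these coordinates carry all of `θ
- θstar`. Markov's inequality with `exp (6R - sum / 2)` then suffices. -/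
theorem seqModel_rejectionRegion_compl_le {θ θstar : Fin p → ℝ} {S Sstar : Finset (Fin p)}
    (hθ : θ ∈ supportedOn S) (hθs : θstar ∈ supportedOn Sstar) :
    seqModel θ (rejectionRegion θstar Sstar)ᶜ ≤
      ENNReal.ofReal (Real.exp (-(1 / 4) * sqLoss θ θstar +
        6 * ((S.card + Sstar.card : ℝ) * Real.log p))) := by
  set R := (S.card + Sstar.card : ℝ) * Real.log p with hR
  refine (measure_le_lintegral_of_one_le (measurableSet_rejectionRegion _ _).compl
    (f := fun y => ENNReal.ofReal (Real.exp (6 * R)) *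
      ENNReal.ofReal (Real.exp (-(1 / 2) * ∑ j ∈ S ∪ Sstar, (y j - θstar j) ^ 2))) ?_).trans ?_
  · intro y hy
    rw [← ENNReal.ofReal_mul (Real.exp_nonneg _), ← Real.exp_add]
    refine ENNReal.one_le_ofReal.2 (Real.one_le_exp ?_)
    simp only [rejectionRegion, Set.mem_compl_iff, Set.mem_iUnion, Set.mem_ofPred_eq,
      not_exists, not_lt] at hy
    linarith [hy S]
  · have h1 : ∀ j, ∫⁻ x, ENNReal.ofReal (Real.exp (-(1 / 2) * (x - θstar j) ^ 2))
        ∂(gaussianReal (θ j) 1) ≤ ENNReal.ofReal (Real.exp (-(θ j - θstar j) ^ 2 / 4)) := by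
      intro j
      refine le_trans (le_of_eq ?_) (lintegral_exp_neg_half_gaussianReal_le (θstar j) (θ j))
      congr 1; funext x; congr 2; ring
    have h2 : sqLoss θ θstar = ∑ j ∈ S ∪ Sstar, (θ j - θstar j) ^ 2 := by
      refine (Finset.sum_subset (Finset.subset_univ _) fun j _ hj => ?_).symm
      rw [Finset.mem_union, not_or] at hj
      simp [hθ j hj.1, hθs j hj.2]
    rw [lintegral_const_mul _ (by fun_prop), lintegral_exp_sum_sq_seqModel]
    refine (mul_le_mul_right (Finset.prod_le_prod' fun j _ => h1 j) _).trans (le_of_eq ?_)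
    rw [← ENNReal.ofReal_prod_of_nonneg fun _ _ => Real.exp_nonneg _, ← Real.exp_sum,
      ← ENNReal.ofReal_mul (Real.exp_nonneg _), ← Real.exp_add, h2, Finset.mul_sum, add_comm]
    congr 3
    exact Finset.sum_congr rfl fun j _ => by ring

theorem testingCondition_seqModel (hp : 2 ≤ p) {θstar : Fin p → ℝ} {Sstar : Finset (Fin p)}
    (hS : Sstar.Nonempty) (hθs : θstar ∈ supportedOn Sstar) {C₂ : ℝ} (hC₂ : 6 ≤ C₂) :
    TestingCondition seqModel sqLoss supportedOn sparseRate θstar Sstar (1 / 4) 1 C₂ := by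
  have hL := log_natCast_ge hp
  have hF := measurableSet_rejectionRegion θstar Sstar
  refine ⟨(rejectionRegion θstar Sstar).indicator 1, measurable_one.indicator hF, fun x => ?_, ?_,
    fun r _ S θ hθ hrθ => ?_⟩
  · by_cases hx : x ∈ rejectionRegion θstar Sstar <;> simp [hx]
  · rw [integral_indicator_one hF]
    refine ENNReal.toReal_le_of_le_ofReal (Real.exp_nonneg _)
      ((seqModel_rejectionRegion_le hp θstar hS).trans (le_of_eq ?_))
    rw [sparseRate, neg_one_mul]
  · have h1 : (fun x => 1 - (rejectionRegion θstar Sstar).indicator (1 : (Fin p → ℝ) → ℝ) x) =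
        (rejectionRegion θstar Sstar)ᶜ.indicator 1 := by
      funext x
      by_cases hx : x ∈ rejectionRegion θstar Sstar <;> simp [hx]
    rw [h1, integral_indicator_one hF.compl]
    refine ENNReal.toReal_le_of_le_ofReal (Real.exp_nonneg _)
      ((seqModel_rejectionRegion_compl_le hθ hθs).trans (ENNReal.ofReal_le_ofReal ?_))
    rw [sparseRate, sparseRate, ← add_mul]
    have hR : 0 ≤ (S.card + Sstar.card : ℝ) * Real.log p := by positivity
    have := mul_le_mul_of_nonneg_right hC₂ hR
    exact Real.exp_le_exp.2 (by linarith)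

end Testing

/-! ### Effective weights and the complexity condition. -/

section Sieve

/-- The tangent-line bound for `A log x` at `u`, exponentiated so that `x = 0` is no exception. -/
theorem rpow_le_exp_mul_rpow {A x u : ℝ} (hA : 0 ≤ A) (hx : 0 ≤ x) (hu : 0 < u) :
    x ^ A ≤ Real.exp (A * (x / u) - A) * u ^ A := by
  have h1 : x / u ≤ Real.exp (x / u - 1) := by linarith [Real.add_one_le_exp (x / u - 1)]
  calc x ^ A = (x / u) ^ A * u ^ A := by
        rw [← Real.mul_rpow (by positivity) hu.le, div_mul_cancel₀ _ hu.ne']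
    _ ≤ Real.exp (x / u - 1) ^ A * u ^ A := by gcongr
    _ = _ := by rw [← Real.exp_mul]; congr 2; ring

theorem rpow_mul_one_sub_rpow_le {A B l u : ℝ} (hA : 0 ≤ A) (hB : 0 ≤ B)
    (hl : l ∈ Set.Icc (0 : ℝ) 1) (hu : u ∈ Set.Ioo (0 : ℝ) 1) :
    l ^ A * (1 - l) ^ B ≤
      Real.exp (A * (l / u) + B * ((1 - l) / (1 - u)) - (A + B)) * (u ^ A * (1 - u) ^ B) := by
  have h1 := rpow_le_exp_mul_rpow hA hl.1 hu.1
  have h2 := rpow_le_exp_mul_rpow hB (sub_nonneg.2 hl.2) (sub_pos.2 hu.2)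
  calc _ ≤ (Real.exp (A * (l / u) - A) * u ^ A) *
        (Real.exp (B * ((1 - l) / (1 - u)) - B) * (1 - u) ^ B) :=
        mul_le_mul h1 h2 (Real.rpow_nonneg (sub_nonneg.2 hl.2) _)
          (mul_nonneg (Real.exp_nonneg _) (Real.rpow_nonneg hu.1.le _))
    _ = _ := by rw [mul_mul_mul_comm, ← Real.exp_add]; congr 2; ring

theorem one_sub_div_add {A B : ℝ} (hA : 0 < A) (hB : 0 < B) :
    1 - A / (A + B) = B / (A + B) := by
  field_simp; ring

theorem odds_div_add {A B : ℝ} (hA : 0 < A) (hB : 0 < B) :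
    A / (A + B) / (1 - A / (A + B)) = A / B := by
  rw [one_sub_div_add hA hB]; field_simp

theorem rpow_mul_one_sub_rpow_le_max {A B l : ℝ} (hA : 0 < A) (hB : 0 < B)
    (hl : l ∈ Set.Icc (0 : ℝ) 1) :
    l ^ A * (1 - l) ^ B ≤ (A / (A + B)) ^ A * (1 - A / (A + B)) ^ B := by
  have hu : A / (A + B) ∈ Set.Ioo (0 : ℝ) 1 :=
    ⟨by positivity, (div_lt_one (by positivity)).2 (by linarith)⟩
  refine (rpow_mul_one_sub_rpow_le hA.le hB.le hl hu).trans (le_of_eq ?_)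
  have h2 : A * (l / (A / (A + B))) + B * ((1 - l) / (B / (A + B))) - (A + B) = 0 := by
    field_simp; ring
  rw [one_sub_div_add hA hB, h2, Real.exp_zero, one_mul]

/-- The true maximiser `a / (a + B)` degenerates to 0 when `a = 0` (that is, `α = 1`). Shifting `a`
to `a + 1` keeps the point interior and costs only a factor `e`. -/
theorem rpow_mul_one_sub_rpow_le_exp_one {a B l : ℝ} (ha : 0 ≤ a) (hB : 0 < B)
    (hl : l ∈ Set.Icc (0 : ℝ) 1) :
    l ^ a * (1 - l) ^ B ≤
      Real.exp 1 * (((a + 1) / (a + 1 + B)) ^ a * (1 - (a + 1) / (a + 1 + B)) ^ B) := by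
  have hu : (a + 1) / (a + 1 + B) ∈ Set.Ioo (0 : ℝ) 1 :=
    ⟨by positivity, (div_lt_one (by positivity)).2 (by linarith)⟩
  refine (rpow_mul_one_sub_rpow_le ha hB.le hl hu).trans ?_
  have h1 : 1 - (a + 1) / (a + 1 + B) = B / (a + 1 + B) := by field_simp; ring
  have h2 : a * (l / ((a + 1) / (a + 1 + B))) + B * ((1 - l) / (B / (a + 1 + B))) - (a + B) =
      1 - l / (a + 1) * (a + 1 + B) := by
    field_simp; ring
  have h3 : 0 ≤ l / (a + 1) * (a + 1 + B) := by
    have := hl.1; positivity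
  refine mul_le_mul_of_nonneg_right (Real.exp_le_exp.2 ?_)
    (mul_nonneg (Real.rpow_nonneg hu.1.le _) (Real.rpow_nonneg (sub_nonneg.2 hu.2.le) _))
  rw [h1, h2]; linarith

variable {p : ℕ} {α β : ℝ}

theorem card_le_fin (S : Finset (Fin p)) : (S.card : ℝ) ≤ p := by
  exact_mod_cast S.card_le_univ.trans_eq (Fintype.card_fin p)

theorem betaWeight_mul_componentWeight (hα : 1 ≤ α) (hβ : 1 ≤ β) {l : ℝ}
    (hl : l ∈ Set.Icc (0 : ℝ) 1) (S : Finset (Fin p)) :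
    betaWeight α β l * componentWeight l S =
      l ^ (α - 1 + S.card) * (1 - l) ^ (β - 1 + p - S.card) := by
  have hcard : S.card ≤ p := S.card_le_univ.trans_eq (Fintype.card_fin p)
  have hl' : 0 ≤ 1 - l := sub_nonneg.2 hl.2
  have h : β - 1 + p - S.card = β - 1 + (p - S.card : ℕ) := by push_cast [hcard]; ring
  rw [h, Real.rpow_add_of_nonneg hl.1 (by linarith) (by positivity),
    Real.rpow_add_of_nonneg hl' (by linarith) (by positivity), Real.rpow_natCast,
    Real.rpow_natCast, betaWeight, componentWeight]
  ring

theorem betaWeight_mul_componentWeight_eq_odds (hα : 1 ≤ α) (hβ : 1 ≤ β) {u : ℝ}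
    (hu : u ∈ Set.Ioo (0 : ℝ) 1) (S : Finset (Fin p)) :
    betaWeight α β u * componentWeight u S =
      (u / (1 - u)) ^ S.card * (u ^ (α - 1) * (1 - u) ^ (β - 1 + p)) := by
  have hu' : 0 < 1 - u := sub_pos.2 hu.2
  rw [betaWeight_mul_componentWeight hα hβ ⟨hu.1.le, hu.2.le⟩, Real.rpow_add hu.1,
    Real.rpow_sub hu', Real.rpow_natCast, Real.rpow_natCast, div_pow]
  ring

/-- The hypothesis on `q` bounds the odds at the maximiser for each `S`; the factor free of `S` is
then bounded uniformly at one common point. -/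
theorem betaWeight_mul_componentWeight_le (hα : 1 ≤ α) (hβ : 1 < β) {q l : ℝ}
    (hq : ∀ S : Finset (Fin p), α - 1 + S.card ≤ q * (β - 1 + p - S.card))
    (hl : l ∈ Set.Icc (0 : ℝ) 1) (S : Finset (Fin p)) :
    betaWeight α β l * componentWeight l S ≤
      q ^ S.card * (Real.exp 1 * ((α / (α + (β - 1 + p))) ^ (α - 1) *
        (1 - α / (α + (β - 1 + p))) ^ (β - 1 + p))) := by
  have hB : 0 < β - 1 + p := by
    have : (0 : ℝ) ≤ p := p.cast_nonneg
    linarith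
  have hbase : ∀ l ∈ Set.Icc (0 : ℝ) 1, l ^ (α - 1) * (1 - l) ^ (β - 1 + p) ≤
      Real.exp 1 * ((α / (α + (β - 1 + p))) ^ (α - 1) *
        (1 - α / (α + (β - 1 + p))) ^ (β - 1 + p)) := by
    intro l hl
    simpa using rpow_mul_one_sub_rpow_le_exp_one (sub_nonneg.2 hα) hB hl
  rcases S.eq_empty_or_nonempty with rfl | hS
  · rw [betaWeight_mul_componentWeight hα hβ.le hl]
    simpa using hbase l hl
  · have hs : (0 : ℝ) < S.card := by exact_mod_cast hS.card_pos
    have hA : 0 < α - 1 + S.card := by linarith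
    have hB' : 0 < β - 1 + p - S.card := by linarith [card_le_fin S]
    set u := (α - 1 + S.card) / (α - 1 + S.card + (β - 1 + p - S.card)) with hu
    have hu01 : u ∈ Set.Ioo (0 : ℝ) 1 :=
      ⟨by positivity, (div_lt_one (by positivity)).2 (by linarith)⟩
    have hodds : u / (1 - u) ≤ q := by
      rw [hu, odds_div_add hA hB', div_le_iff₀ hB']
      exact hq S
    have hodds0 : 0 ≤ u / (1 - u) := div_nonneg hu01.1.le (sub_nonneg.2 hu01.2.le)
    have hu01' : u ∈ Set.Icc (0 : ℝ) 1 := ⟨hu01.1.le, hu01.2.le⟩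
    calc betaWeight α β l * componentWeight l S ≤ betaWeight α β u * componentWeight u S := by
          rw [betaWeight_mul_componentWeight hα hβ.le hl,
            betaWeight_mul_componentWeight hα hβ.le hu01']
          exact rpow_mul_one_sub_rpow_le_max hA hB' hl
      _ = (u / (1 - u)) ^ S.card * (u ^ (α - 1) * (1 - u) ^ (β - 1 + p)) :=
          betaWeight_mul_componentWeight_eq_odds hα hβ.le hu01 S
      _ ≤ _ := mul_le_mul (pow_le_pow_left₀ hodds0 hodds _) (hbase u hu01')
          (mul_nonneg (Real.rpow_nonneg hu01.1.le _)
            (Real.rpow_nonneg (sub_nonneg.2 hu01.2.le) _))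
          (pow_nonneg (hodds0.trans hodds) _)

theorem exists_isGreatest_weight (hα : 1 ≤ α) (hβ : 1 ≤ β) (S : Finset (Fin p)) :
    ∃ g, IsGreatest ((fun l => betaWeight α β l * componentWeight l S) '' Set.Icc (0 : ℝ) 1) g := by
  have hc : Continuous fun l : ℝ => betaWeight α β l * componentWeight l S := by
    unfold betaWeight componentWeight
    have h1 := Real.continuous_rpow_const (sub_nonneg.2 hα)
    have h2 := (Real.continuous_rpow_const (sub_nonneg.2 hβ)).comp (continuous_sub_left (1 : ℝ))
    exact (h1.mul h2).mul (by fun_prop)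
  exact (isCompact_Icc.image hc).exists_isGreatest ((Set.nonempty_Icc.2 zero_le_one).image _)

theorem sieveCondition_betaWeight (hp : 2 ≤ p) {C₂ C₁' C₂' : ℝ} (hC₂ : 0 ≤ C₂)
    (hC₂' : 3 + 2 * C₂ ≤ C₂') (hα : 1 ≤ α) (hlow : (p : ℝ) ^ C₂' ≤ β / α)
    (hup : β / α ≤ (p : ℝ) ^ C₁') {Sstar : Finset (Fin p)} (hS : Sstar.Nonempty) :
    SieveCondition (Set.Icc (0 : ℝ) 1) (betaWeight α β) componentWeight sparseRate (fun _ => 1)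
      Sstar C₂ (C₁' + 4) := by
  have hL := log_natCast_ge hp
  have hp0 : (0 : ℝ) < p := by positivity
  have hp2 : (2 : ℝ) ≤ p := by exact_mod_cast hp
  have hα0 : 0 < α := by linarith
  have hpexp : Real.exp (Real.log p) = p := Real.exp_log hp0
  rw [Real.rpow_def_of_pos hp0, le_div_iff₀ hα0] at hlow
  rw [Real.rpow_def_of_pos hp0, div_le_iff₀ hα0] at hup
  have hβ2 : 2 ≤ β := by
    have h1 : (p : ℝ) ≤ Real.exp (Real.log p * C₂') := by
      conv_lhs => rw [← hpexp]
      exact Real.exp_le_exp.2 (by nlinarith)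
    nlinarith
  have hβ : 1 < β := by linarith
  have hB : 0 < β - 1 + p := by linarith
  -- Two powers of `p` are given up: one for `α - 1 + |S| ≤ αp`, one for the `1/2` in `β - 1 + p -
  -- |S| ≥ β/2`.
  set q := Real.exp (-(C₂' - 2) * Real.log p) with hq_def
  have hq : ∀ S : Finset (Fin p), α - 1 + S.card ≤ q * (β - 1 + p - S.card) := by
    intro S
    have h1 : q * Real.exp (Real.log p * C₂') = p * p := by
      rw [hq_def, ← Real.exp_add]
      conv_rhs => rw [← hpexp, ← Real.exp_add]
      congr 1; ring
    have h2 := card_le_fin S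
    calc α - 1 + S.card ≤ α * p := by nlinarith
      _ ≤ q * (Real.exp (Real.log p * C₂') * α / 2) := by
          have : q * (Real.exp (Real.log p * C₂') * α / 2) = p * p * α / 2 := by
            rw [← h1]; ring
          rw [this]
          nlinarith [mul_pos hα0 hp0]
      _ ≤ q * (β - 1 + p - S.card) := by
          gcongr
          linarith
  -- The oracle `λ*` is the point where the factor free of `S` was bounded, so that factor `W`
  -- cancels in the ratio.
  set u := α / (α + (β - 1 + p)) with hu
  have hu01 : u ∈ Set.Ioo (0 : ℝ) 1 :=
    ⟨by positivity, (div_lt_one (by positivity)).2 (by linarith)⟩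
  set W := u ^ (α - 1) * (1 - u) ^ (β - 1 + p) with hW
  have hW0 : 0 < W :=
    mul_pos (Real.rpow_pos_of_pos hu01.1 _) (Real.rpow_pos_of_pos (sub_pos.2 hu01.2) _)
  have hodds : Real.exp (-(C₁' + 1) * Real.log p) ≤ u / (1 - u) := by
    rw [hu, odds_div_add hα0 hB, le_div_iff₀ hB]
    have h2 : Real.exp (-(C₁' + 1) * Real.log p) * (Real.exp (Real.log p * C₁') * p) = 1 := by
      conv_lhs => rw [← hpexp, ← Real.exp_add, ← Real.exp_add, Real.log_exp]
      rw [Real.exp_eq_one_iff]; ring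
    calc Real.exp (-(C₁' + 1) * Real.log p) * (β - 1 + p)
        ≤ Real.exp (-(C₁' + 1) * Real.log p) * (Real.exp (Real.log p * C₁') * α * p) := by
          gcongr
          nlinarith
      _ = Real.exp (-(C₁' + 1) * Real.log p) * (Real.exp (Real.log p * C₁') * p) * α := by ring
      _ = α := by rw [h2, one_mul]
  have hden : Real.exp (-(C₁' + 1) * Real.log p) ^ Sstar.card * W ≤
      betaWeight α β u * componentWeight u Sstar := by
    rw [betaWeight_mul_componentWeight_eq_odds hα hβ.le hu01]
    gcongr
  have hden0 : 0 < Real.exp (-(C₁' + 1) * Real.log p) ^ Sstar.card * W := by positivity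
  choose γ hγ using exists_isGreatest_weight (p := p) hα hβ.le
  refine ⟨u, ⟨hu01.1.le, hu01.2.le⟩, γ, hγ, hden0.trans_le hden, ?_⟩
  have hγle : ∀ S, γ S ≤ q ^ S.card * (Real.exp 1 * W) := by
    intro S
    obtain ⟨l, hl, hle⟩ := (hγ S).1
    rw [← hle]
    exact betaWeight_mul_componentWeight_le hα hβ hq hl S
  have hs : (1 : ℝ) ≤ Sstar.card := by exact_mod_cast hS.card_pos
  simp only [mul_one]
  calc _ ≤ ∑ S : Finset (Fin p), Real.exp (1 + (C₁' + 1) * (Sstar.card * Real.log p)) *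
        Real.exp (-Real.log p * S.card) := by
        refine Finset.sum_le_sum fun S _ => ?_
        calc γ S / (betaWeight α β u * componentWeight u Sstar) *
              Real.exp (2 * C₂ * sparseRate S)
            ≤ q ^ S.card * (Real.exp 1 * W) /
              (Real.exp (-(C₁' + 1) * Real.log p) ^ Sstar.card * W) *
              Real.exp (2 * C₂ * sparseRate S) := by
              gcongr
              exact hγle S
          _ = q ^ S.card * Real.exp 1 *
              (Real.exp (-(C₁' + 1) * Real.log p) ^ Sstar.card)⁻¹ *
              Real.exp (2 * C₂ * sparseRate S) := by
              field_simp
          _ ≤ _ := by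
              rw [hq_def, ← Real.exp_nat_mul, ← Real.exp_nat_mul, ← Real.exp_neg,
                ← Real.exp_add, ← Real.exp_add, ← Real.exp_add, ← Real.exp_add, sparseRate]
              refine Real.exp_le_exp.2 ?_
              -- `C₂' ≥ 3 + 2C₂` leaves a factor of at most `p⁻¹` per element of `S`.
              have : 0 ≤ (S.card * Real.log p) * (C₂' - (3 + 2 * C₂)) :=
                mul_nonneg (by positivity) (by linarith)
              nlinarith
    _ ≤ Real.exp (1 + (C₁' + 1) * (Sstar.card * Real.log p)) * Real.exp 1 := by
        rw [← Finset.mul_sum]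
        gcongr
        exact sum_exp_neg_mul_card_le hp le_rfl
    _ ≤ _ := by
        rw [← Real.exp_add, sparseRate]
        refine Real.exp_le_exp.2 ?_
        -- The two factors `e` fit into `exp (3r)` since `3 · 0.69 > 2`; hence `C₄ = C₁' + 4`.
        nlinarith

end Sieve

/-! ### The prior mass ratio condition. -/

section PriorMass

variable {τ : ℝ} {p : ℕ}

theorem slabConst_pow_le_exp {C₂ : ℝ} (hτ : 0 < τ) (hκ : slabConst τ ≤ Real.exp (C₂ * Real.log p))
    (n : ℕ) : slabConst τ ^ n ≤ Real.exp (C₂ * (n * Real.log p)) := by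
  calc _ ≤ Real.exp (C₂ * Real.log p) ^ n := pow_le_pow_left₀ (slabConst_pos hτ).le hκ n
    _ = _ := by rw [← Real.exp_nat_mul]; congr 1; ring

theorem card_le_two_mul_sparseRate (hp : 2 ≤ p) (S : Finset (Fin p)) :
    (S.card : ℝ) ≤ 2 * sparseRate S := by
  have := log_natCast_ge hp
  have h : (0 : ℝ) ≤ S.card := S.card.cast_nonneg
  unfold sparseRate
  nlinarith

theorem component_sqLoss_le_le (hτ : 0 < τ) (S Sstar : Finset (Fin p)) {θstar : Fin p → ℝ}
    (hθ : θstar ∈ supportedOn Sstar) (r : ℝ) :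
    component τ S {θ | sqLoss θ θstar ≤ r} ≤
      ENNReal.ofReal (Real.exp (1 / 16 * r) * slabConst τ ^ Sstar.card) *
        component τ Sstar {θ | θ ∈ supportedOn Sstar ∧ sqLoss θ θstar ≤ Sstar.card} := by
  have hm := measurable_sqLoss θstar
  refine (measure_le_lintegral_of_one_le (measurableSet_le hm measurable_const)
    (f := fun θ => ENNReal.ofReal (Real.exp (1 / 16 * r)) *
      ENNReal.ofReal (Real.exp (-(1 / 16) * sqLoss θ θstar))) fun θ hr => ?_).trans ?_
  · rw [← ENNReal.ofReal_mul (Real.exp_nonneg _), ← Real.exp_add]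
    refine ENNReal.one_le_ofReal.2 (Real.one_le_exp ?_)
    have : sqLoss θ θstar ≤ r := hr
    linarith
  · rw [lintegral_const_mul _ (by fun_prop), ENNReal.ofReal_mul (Real.exp_nonneg _), mul_assoc]
    exact mul_le_mul_right (lintegral_exp_neg_sqLoss_component_le hτ S Sstar hθ) _

theorem priorMassCondition_component (hτ : 0 < τ) (hp : 2 ≤ p) {C₂ : ℝ} (hC₂ : 0 ≤ C₂)
    (hκ : slabConst τ ≤ Real.exp (C₂ * Real.log p)) {θstar : Fin p → ℝ} {Sstar : Finset (Fin p)}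
    (hθ : θstar ∈ supportedOn Sstar) :
    PriorMassCondition seqModel sqLoss supportedOn (component τ) sparseRate (fun _ => 1)
      θstar Sstar 2 C₂ 2 (1 / 16) := by
  have := isProbabilityMeasure_component (p := p) hτ
  set E : Set (Fin p → ℝ) := {θ | θ ∈ supportedOn Sstar ∧
    renyiDiv 2 (seqModel θstar) (seqModel θ) ≤ ((2 * sparseRate Sstar : ℝ) : EReal)} with hE
  have hsub : {θ | θ ∈ supportedOn Sstar ∧ sqLoss θ θstar ≤ Sstar.card} ⊆ E := fun θ h =>
    ⟨h.1, (renyiDiv_two_le_sqLoss θ θstar).trans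
      (EReal.coe_le_coe_iff.2 (h.2.trans (card_le_two_mul_sparseRate hp Sstar)))⟩
  have hpos : 0 < (component τ Sstar).real E :=
    ENNReal.toReal_pos ((component_ball_pos hτ Sstar hθ).trans_le (measure_mono hsub)).ne'
      (measure_ne_top _ _)
  refine ⟨hpos, fun r _ S => ?_⟩
  rw [div_le_iff₀ hpos, div_one, one_mul, Measure.real, Measure.real,
    ← ENNReal.toReal_ofReal (Real.exp_nonneg _), ← ENNReal.toReal_mul]
  refine ENNReal.toReal_mono (ENNReal.mul_ne_top ENNReal.ofReal_ne_top (measure_ne_top _ _)) ?_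
  refine (measure_mono fun θ h => h.2).trans ((component_sqLoss_le_le hτ S Sstar hθ r).trans
    (mul_le_mul' (ENNReal.ofReal_le_ofReal ?_) (measure_mono hsub)))
  have hL := log_natCast_ge hp
  have hS : 0 ≤ sparseRate S := by unfold sparseRate; positivity
  calc _ ≤ Real.exp (1 / 16 * r) * Real.exp (C₂ * sparseRate Sstar) := by
        gcongr; exact slabConst_pow_le_exp hτ hκ _
    _ ≤ _ := by
        rw [← Real.exp_add]
        gcongr
        linarith

end PriorMass

/-! ### Pointwise bounds for the empirical Bayes posterior. -/

section Posterior

variable {τ α β : ℝ} {p : ℕ}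

theorem posterior_apply (l : ℝ) (y : Fin p → ℝ) {B : Set (Fin p → ℝ)} (hB : MeasurableSet B) :
    posterior τ l y B = (marginal τ l y)⁻¹ * ∫⁻ θ in B, likelihood y θ ∂(prior p τ l) := by
  rw [posterior, Measure.smul_apply, smul_eq_mul, withDensity_apply _ hB]

theorem posterior_le_one (l : ℝ) (y : Fin p → ℝ) (B : Set (Fin p → ℝ)) :
    posterior τ l y B ≤ 1 := by
  refine (measure_mono (Set.subset_univ B)).trans ?_
  rw [posterior_apply _ _ MeasurableSet.univ, setLIntegral_univ]
  exact ENNReal.inv_mul_le_one _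

/-- Replacing the selected hyperparameter by an oracle in the denominator and by the effective
weights in the numerator. -/
theorem posterior_le_div (hτ : 0 < τ) {lhat : (Fin p → ℝ) → ℝ}
    (hlhat : IsEmpiricalBayesSelector τ α β lhat) (y : Fin p → ℝ) {B : Set (Fin p → ℝ)}
    (hB : MeasurableSet B) {γ : Finset (Fin p) → ℝ}
    (hγ : ∀ S, IsGreatest ((fun l => betaWeight α β l * componentWeight l S) '' Set.Icc (0 : ℝ) 1)
      (γ S)) {lstar : ℝ} (hlstar : lstar ∈ Set.Icc (0 : ℝ) 1) (Sstar : Finset (Fin p))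
    {d : ℝ≥0∞} (hd0 : d ≠ 0)
    (hd : d ≤ ENNReal.ofReal (betaWeight α β lstar * componentWeight lstar Sstar) *
      ∫⁻ θ, likelihood y θ ∂(component τ Sstar)) :
    posterior τ (lhat y) y B ≤
      d⁻¹ * ∑ S, ENNReal.ofReal (γ S) * ∫⁻ θ in B, likelihood y θ ∂(component τ S) := by
  obtain ⟨hl, hmax⟩ := hlhat y
  have hw : ∀ l ∈ Set.Icc (0 : ℝ) 1, 0 ≤ betaWeight α β l := fun l hl =>
    mul_nonneg (Real.rpow_nonneg hl.1 _) (Real.rpow_nonneg (sub_nonneg.2 hl.2) _)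
  have h1 : ENNReal.ofReal (betaWeight α β lstar) * marginal τ lstar y ≤
      ENNReal.ofReal (betaWeight α β (lhat y)) * marginal τ (lhat y) y :=
    ENNReal.log_le_log_iff.1 (hmax hlstar)
  have h2 : d ≤ ENNReal.ofReal (betaWeight α β lstar) * marginal τ lstar y := by
    refine hd.trans ?_
    rw [ENNReal.ofReal_mul (hw _ hlstar), mul_assoc, marginal,
      ← setLIntegral_univ (μ := prior p τ lstar), setLIntegral_prior hτ hlstar _ MeasurableSet.univ]
    simp_rw [setLIntegral_univ]
    exact mul_le_mul_right (Finset.single_le_sum (f := fun S : Finset (Fin p) =>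
      ENNReal.ofReal (componentWeight lstar S) * ∫⁻ θ, likelihood y θ ∂(component τ S))
      (fun _ _ => zero_le) (Finset.mem_univ Sstar)) _
  set w := ENNReal.ofReal (betaWeight α β (lhat y)) with hw_def
  -- The weight may vanish at an endpoint of `[0, 1]`, but a maximiser cannot lie there, the
  -- objective being positive at `lstar`.
  have hw0 : w ≠ 0 := by
    intro h0
    rw [h0, zero_mul] at h1
    exact hd0 (nonpos_iff_eq_zero.1 (h2.trans h1))
  calc posterior τ (lhat y) y B
      = (w * marginal τ (lhat y) y)⁻¹ *
        (w * ∫⁻ θ in B, likelihood y θ ∂(prior p τ (lhat y))) := by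
        rw [posterior_apply _ _ hB, ENNReal.mul_inv (Or.inl hw0) (Or.inl ENNReal.ofReal_ne_top),
          mul_mul_mul_comm, ENNReal.inv_mul_cancel hw0 ENNReal.ofReal_ne_top, one_mul]
    _ ≤ _ := by
        refine mul_le_mul' (ENNReal.inv_le_inv.2 (h2.trans h1)) ?_
        rw [setLIntegral_prior hτ hl _ hB, Finset.mul_sum]
        refine Finset.sum_le_sum fun S _ => ?_
        rw [← mul_assoc, hw_def, ← ENNReal.ofReal_mul (hw _ hl)]
        exact mul_le_mul_left (ENNReal.ofReal_le_ofReal ((hγ S).2 ⟨_, hl, rfl⟩)) _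

/-- Cauchy–Schwarz for `f ^ (1/2) * f ^ (-1/2) = 1`. With `f` the likelihood, small evidence forces
a large integral of its inverse, whose mean is a chi-square moment. -/
theorem sq_measure_le_lintegral_mul_lintegral_inv {X : Type*} [MeasurableSpace X] (μ : Measure X)
    {f : X → ℝ≥0∞} (hf : Measurable f) (h0 : ∀ x, f x ≠ 0) (ht : ∀ x, f x ≠ ∞) :
    μ Set.univ ^ 2 ≤ (∫⁻ x, f x ∂μ) * ∫⁻ x, (f x)⁻¹ ∂μ := by
  have h := ENNReal.lintegral_mul_le_Lp_mul_Lq μ Real.HolderConjugate.two_two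
    (hf.pow_const (1 / 2 : ℝ)).aemeasurable (hf.inv.pow_const (1 / 2 : ℝ)).aemeasurable
  have h1 : ∀ x, f x ^ (1 / 2 : ℝ) * (f x)⁻¹ ^ (1 / 2 : ℝ) = 1 := by
    intro x
    rw [← ENNReal.mul_rpow_of_nonneg _ _ (by norm_num), ENNReal.mul_inv_cancel (h0 x) (ht x),
      ENNReal.one_rpow]
  have h2 : μ Set.univ ≤ _ :=
    (lintegral_one.symm.trans (lintegral_congr fun x => (h1 x).symm)).trans_le h
  simp only [← ENNReal.rpow_mul] at h2
  norm_num at h2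
  calc μ Set.univ ^ 2 ≤ ((∫⁻ x, f x ∂μ) ^ (1 / 2 : ℝ) * (∫⁻ x, (f x)⁻¹ ∂μ) ^ (1 / 2 : ℝ)) ^ 2 := by
        gcongr
    _ = _ := by
        rw [mul_pow, ← ENNReal.rpow_natCast, ← ENNReal.rpow_natCast, ← ENNReal.rpow_mul,
          ← ENNReal.rpow_mul]
        norm_num

theorem ae_mem_supportedOn (hτ : 0 < τ) (S : Finset (Fin p)) :
    ∀ᵐ θ ∂(component τ S), θ ∈ supportedOn S := by
  have := isProbabilityMeasure_slab_or_dirac hτ S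
  refine ae_all_iff.2 fun j => ?_
  by_cases hj : j ∈ S
  · exact ae_of_all _ fun θ h => absurd hj h
  · have h : ∀ᵐ x ∂(if j ∈ S then laplace τ else Measure.dirac (0 : ℝ)), x = 0 := by
      rw [if_neg hj]
      exact (ae_dirac_iff (p := fun x => x = 0) (measurableSet_singleton 0)).2 rfl
    exact ((Measure.tendsto_eval_ae_ae (μ := fun j => if j ∈ S then laplace τ else
      Measure.dirac (0 : ℝ)) (i := j)).eventually h).mono fun θ h _ => h

end Posterior

/-! ### Posterior contraction. -/

section Contraction

variable {τ α β : ℝ} {p : ℕ}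

theorem measurable_lintegral_likelihood (μ : Measure (Fin p → ℝ)) [SFinite μ] :
    Measurable fun y => ∫⁻ θ, likelihood y θ ∂μ :=
  Measurable.lintegral_prod_right' (f := fun z : (Fin p → ℝ) × (Fin p → ℝ) => likelihood z.1 z.2)
    measurable_likelihood_uncurry

theorem measurable_lintegral_inv_likelihood (μ : Measure (Fin p → ℝ)) [SFinite μ] :
    Measurable fun y => ∫⁻ θ, (likelihood y θ)⁻¹ ∂μ :=
  Measurable.lintegral_prod_right'
    (f := fun z : (Fin p → ℝ) × (Fin p → ℝ) => (likelihood z.1 z.2)⁻¹)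
    measurable_likelihood_uncurry.inv

theorem setLIntegral_lintegral_likelihood (μ : Measure (Fin p → ℝ)) [SFinite μ]
    {A : Set (Fin p → ℝ)} (hA : MeasurableSet A) :
    ∫⁻ y in A, ∫⁻ θ, likelihood y θ ∂μ = ∫⁻ θ, seqModel θ A ∂μ := by
  rw [lintegral_lintegral_swap measurable_likelihood_uncurry.aemeasurable]
  refine lintegral_congr fun θ => ?_
  rw [seqModel_eq_withDensity, withDensity_apply _ hA]

theorem lintegral_lintegral_likelihood_sq_div (μ : Measure (Fin p → ℝ)) [SFinite μ]
    (θstar : Fin p → ℝ) :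
    ∫⁻ y, likelihood y θstar * (likelihood y θstar * ∫⁻ θ, (likelihood y θ)⁻¹ ∂μ) =
      ∫⁻ θ, ENNReal.ofReal (Real.exp (sqLoss θ θstar)) ∂μ := by
  have hm : Measurable fun z : (Fin p → ℝ) × (Fin p → ℝ) =>
      likelihood z.1 θstar * (likelihood z.1 θstar * (likelihood z.1 z.2)⁻¹) := by
    have h : Measurable fun z : (Fin p → ℝ) × (Fin p → ℝ) => likelihood z.1 θstar :=
      (measurable_likelihood_left θstar).comp measurable_fst
    exact h.mul (h.mul measurable_likelihood_uncurry.inv)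
  simp_rw [← lintegral_likelihood_sq_div]
  rw [← lintegral_lintegral_swap (μ := volume) (ν := μ) hm.aemeasurable]
  refine lintegral_congr fun y => ?_
  have h : Measurable fun θ => (likelihood y θ)⁻¹ := (measurable_likelihood_right y).inv
  rw [lintegral_const_mul _ (h.const_mul _), lintegral_const_mul _ h]

/-- Splits the posterior mass into the type-I error, the mass on the acceptance region, and the
event that the evidence is small. -/
theorem posterior_le_split (hτ : 0 < τ) {lhat : (Fin p → ℝ) → ℝ}
    (hlhat : IsEmpiricalBayesSelector τ α β lhat) (y : Fin p → ℝ) {B D F : Set (Fin p → ℝ)}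
    (hB : MeasurableSet B) {γ : Finset (Fin p) → ℝ}
    (hγ : ∀ S, IsGreatest ((fun l => betaWeight α β l * componentWeight l S) '' Set.Icc (0 : ℝ) 1)
      (γ S)) {lstar : ℝ} (hlstar : lstar ∈ Set.Icc (0 : ℝ) 1) (Sstar : Finset (Fin p))
    (hW : 0 < betaWeight α β lstar * componentWeight lstar Sstar) (θstar : Fin p → ℝ)
    (hD : component τ Sstar D ≠ 0) {η : ℝ≥0∞} (hη : η ≠ 0) :
    posterior τ (lhat y) y B ≤
      F.indicator 1 y +
      Fᶜ.indicator (fun y =>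
        (ENNReal.ofReal (betaWeight α β lstar * componentWeight lstar Sstar) *
          (component τ Sstar D * η))⁻¹ * ((likelihood y θstar)⁻¹ *
          ∑ S, ENNReal.ofReal (γ S) * ∫⁻ θ in B, likelihood y θ ∂(component τ S))) y +
      η * (component τ Sstar D)⁻¹ *
        (likelihood y θstar * ∫⁻ θ in D, (likelihood y θ)⁻¹ ∂(component τ Sstar)) := by
  have := isProbabilityMeasure_component (p := p) hτ
  set q := component τ Sstar D with hq
  have hq' : q ≠ ∞ := measure_ne_top _ _
  set L := likelihood y θstar
  have hL0 : L ≠ 0 := likelihood_ne_zero _ _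
  have hLt : L ≠ ∞ := likelihood_ne_top _ _
  by_cases hy : y ∈ F
  · rw [Set.indicator_of_mem hy, Pi.one_apply, add_assoc]
    exact (posterior_le_one _ _ _).trans le_self_add
  rw [Set.indicator_of_notMem hy, zero_add, Set.indicator_of_mem (Set.mem_compl hy)]
  set w := ENNReal.ofReal (betaWeight α β lstar * componentWeight lstar Sstar)
  have hw0 : w ≠ 0 := (ENNReal.ofReal_pos.2 hW).ne'
  have hwt : w ≠ ∞ := ENNReal.ofReal_ne_top
  -- If the evidence on `D` is large, it serves as the denominator. Otherwise Cauchy–Schwarz makes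
  -- the third summand at least 1, which already dominates a posterior probability.
  by_cases hZ : L * (q * η) ≤ ∫⁻ θ in D, likelihood y θ ∂(component τ Sstar)
  · refine le_add_right ((posterior_le_div hτ hlhat y hB hγ hlstar Sstar (d := w * (q * η) * L)
      (by simp [hw0, hD, hη, hL0]) ?_).trans (le_of_eq ?_))
    · rw [mul_assoc, mul_comm _ L]
      exact mul_le_mul_right (hZ.trans (setLIntegral_le_lintegral _ _)) _
    · rw [ENNReal.mul_inv (Or.inr hLt) (Or.inr hL0), mul_assoc]
  · refine (posterior_le_one _ _ _).trans (le_add_left ?_)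
    have h1 := sq_measure_le_lintegral_mul_lintegral_inv ((component τ Sstar).restrict D)
      (measurable_likelihood_right y) (likelihood_ne_zero y) (likelihood_ne_top y)
    rw [Measure.restrict_apply_univ, ← hq] at h1
    set V := ∫⁻ θ in D, (likelihood y θ)⁻¹ ∂(component τ Sstar)
    have h2 : q * q ≤ q * (η * (L * V)) := by
      calc q * q = q ^ 2 := (sq q).symm
        _ ≤ _ := h1
        _ ≤ (L * (q * η)) * V := mul_le_mul_left (not_le.1 hZ).le _
        _ = _ := by ring
    have h3 : q ≤ η * (L * V) := (ENNReal.mul_le_mul_iff_right hD hq').1 h2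
    calc 1 = q⁻¹ * q := (ENNReal.inv_mul_cancel hD hq').symm
      _ ≤ q⁻¹ * (η * (L * V)) := mul_le_mul_right h3 _
      _ = _ := by ring

/-- Of the type-II exponent `1/4`, the share `3/16` is spent on the lower bound for the loss and
`1/16` is kept as the integrable weight. -/
theorem setLIntegral_seqModel_accept_le (hτ : 0 < τ) {C₂ M : ℝ}
    (hκ : slabConst τ ≤ Real.exp (C₂ * Real.log p)) {θstar : Fin p → ℝ}
    {Sstar : Finset (Fin p)} (hθ : θstar ∈ supportedOn Sstar) (S : Finset (Fin p)) :
    ∫⁻ θ in {θ | M * sparseRate Sstar < sqLoss θ θstar},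
        seqModel θ (rejectionRegion θstar Sstar)ᶜ ∂(component τ S) ≤
      ENNReal.ofReal (Real.exp (6 * sparseRate S + (6 + C₂ - 3 / 16 * M) * sparseRate Sstar)) *
        component τ Sstar {θ | θ ∈ supportedOn Sstar ∧ sqLoss θ θstar ≤ Sstar.card} := by
  have hm := measurable_sqLoss θstar
  set r := sparseRate Sstar with hr
  calc _ ≤ ∫⁻ θ in {θ | M * r < sqLoss θ θstar},
        ENNReal.ofReal (Real.exp (6 * sparseRate S + (6 - 3 / 16 * M) * r)) *
          ENNReal.ofReal (Real.exp (-(1 / 16) * sqLoss θ θstar)) ∂(component τ S) := by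
        refine lintegral_mono_ae ?_
        rw [ae_restrict_iff' (measurableSet_lt measurable_const hm)]
        refine (ae_mem_supportedOn hτ S).mono fun θ hS hlt => ?_
        refine (seqModel_rejectionRegion_compl_le hS hθ).trans ?_
        rw [← ENNReal.ofReal_mul (Real.exp_nonneg _), ← Real.exp_add]
        refine ENNReal.ofReal_le_ofReal (Real.exp_le_exp.2 ?_)
        have : M * r < sqLoss θ θstar := hlt
        rw [add_mul]
        change _ + 6 * (sparseRate S + r) ≤ _
        linarith
    _ ≤ ENNReal.ofReal (Real.exp (6 * sparseRate S + (6 - 3 / 16 * M) * r)) *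
          ∫⁻ θ, ENNReal.ofReal (Real.exp (-(1 / 16) * sqLoss θ θstar)) ∂(component τ S) := by
        rw [← lintegral_const_mul _ (by fun_prop)]
        exact setLIntegral_le_lintegral _ _
    _ ≤ ENNReal.ofReal (Real.exp (6 * sparseRate S + (6 - 3 / 16 * M) * r)) *
          (ENNReal.ofReal (Real.exp (C₂ * r)) *
            component τ Sstar {θ | θ ∈ supportedOn Sstar ∧ sqLoss θ θstar ≤ Sstar.card}) := by
        refine mul_le_mul_right
          ((lintegral_exp_neg_sqLoss_component_le hτ S Sstar hθ).trans ?_) _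
        exact mul_le_mul_left (ENNReal.ofReal_le_ofReal (slabConst_pow_le_exp hτ hκ _)) _
    _ = _ := by
        rw [← mul_assoc, ← ENNReal.ofReal_mul (Real.exp_nonneg _), ← Real.exp_add]
        congr 3; ring

theorem lintegral_posterior_le (hτ : 0 < τ) (hp : 2 ≤ p) {C₂ C₄ : ℝ} (hC₂ : 6 ≤ C₂)
    (hκ : slabConst τ ≤ Real.exp (C₂ * Real.log p)) {θstar : Fin p → ℝ} {Sstar : Finset (Fin p)}
    (hS : Sstar.Nonempty) (hθ : θstar ∈ supportedOn Sstar)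
    (hsieve : SieveCondition (Set.Icc (0 : ℝ) 1) (betaWeight α β) componentWeight sparseRate
      (fun _ => 1) Sstar C₂ C₄)
    {lhat : (Fin p → ℝ) → ℝ} (hlhat : IsEmpiricalBayesSelector τ α β lhat) :
    ∫⁻ y, posterior τ (lhat y) y
        {θ | 16 / 3 * (10 + C₂ + C₄) * sparseRate Sstar < sqLoss θ θstar} ∂(seqModel θstar) ≤
      ENNReal.ofReal (4 * Real.exp (-sparseRate Sstar)) := by
  have := isProbabilityMeasure_component (p := p) hτ
  have hm := measurable_sqLoss θstar
  obtain ⟨lstar, hlstar, γ, hγ, hW, hsum⟩ := hsieve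
  simp only [mul_one] at hsum
  set r := sparseRate Sstar with hr
  -- Solves `C₄ + 9 + C₂ - (3/16) M = -1`, the exponent of the middle term.
  set M := 16 / 3 * (10 + C₂ + C₄) with hM
  set B := {θ | M * r < sqLoss θ θstar} with hB_def
  have hB : MeasurableSet B := measurableSet_lt measurable_const hm
  set D := {θ | θ ∈ supportedOn Sstar ∧ sqLoss θ θstar ≤ Sstar.card} with hD_def
  have hD : MeasurableSet D :=
    (measurableSet_supportedOn Sstar).inter (measurableSet_le hm measurable_const)
  set q := component τ Sstar D with hq_def
  have hq : q ≠ 0 := (component_ball_pos hτ Sstar hθ).ne'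
  have hq' : q ≠ ∞ := measure_ne_top _ _
  set F := rejectionRegion θstar Sstar with hF_def
  have hF : MeasurableSet F := measurableSet_rejectionRegion θstar Sstar
  -- On `D` the chi-square moment is at most `exp (2r)`, so `η` leaves `exp (-r)`.
  set η := ENNReal.ofReal (Real.exp (-(3 * r))) with hη_def
  have hη : η ≠ 0 := (ENNReal.ofReal_pos.2 (Real.exp_pos _)).ne'
  have hη' : η ≠ ∞ := ENNReal.ofReal_ne_top
  set W := betaWeight α β lstar * componentWeight lstar Sstar with hW_def
  set N : (Fin p → ℝ) → ℝ≥0∞ :=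
    fun y => ∑ S, ENNReal.ofReal (γ S) * ∫⁻ θ in B, likelihood y θ ∂(component τ S) with hN_def
  have hNm : Measurable N :=
    Finset.measurable_sum _ fun S _ => (measurable_lintegral_likelihood _).const_mul _
  set V : (Fin p → ℝ) → ℝ≥0∞ := fun y => ∫⁻ θ in D, (likelihood y θ)⁻¹ ∂(component τ Sstar)
  have hVm : Measurable V := measurable_lintegral_inv_likelihood _
  have hLm := measurable_likelihood_left θstar
  have hLV : Measurable fun y => likelihood y θstar * V y := hLm.mul hVm
  have hγ0 : ∀ S, 0 ≤ γ S := fun S => by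
    obtain ⟨l, hl, hle⟩ := (hγ S).1
    rw [← hle]
    exact mul_nonneg (mul_nonneg (Real.rpow_nonneg hl.1 _)
      (Real.rpow_nonneg (sub_nonneg.2 hl.2) _)) (componentWeight_nonneg hl S)
  have hgm : Measurable (Fᶜ.indicator fun y =>
      (ENNReal.ofReal W * (q * η))⁻¹ * ((likelihood y θstar)⁻¹ * N y)) :=
    ((hLm.inv.mul hNm).const_mul _).indicator hF.compl
  have hfirst : ∫⁻ y, F.indicator 1 y ∂(seqModel θstar) ≤ ENNReal.ofReal (Real.exp (-r)) := by
    rw [lintegral_indicator_one hF]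
    exact seqModel_rejectionRegion_le hp θstar hS
  have hsecond : ∫⁻ y, Fᶜ.indicator (fun y =>
      (ENNReal.ofReal W * (q * η))⁻¹ * ((likelihood y θstar)⁻¹ * N y)) y ∂(seqModel θstar) ≤
        ENNReal.ofReal (Real.exp (-r)) := by
    calc _ = ∫⁻ y in Fᶜ, (ENNReal.ofReal W * (q * η))⁻¹ * N y := by
          rw [seqModel_eq_withDensity, lintegral_withDensity_eq_lintegral_mul _ hLm hgm,
            ← lintegral_indicator hF.compl]
          refine lintegral_congr fun y => ?_
          rw [Pi.mul_apply]
          by_cases hy : y ∈ Fᶜ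
          · rw [Set.indicator_of_mem hy, Set.indicator_of_mem hy, mul_left_comm, ← mul_assoc _ _ (N y),
              ENNReal.mul_inv_cancel (likelihood_ne_zero _ _) (likelihood_ne_top _ _), one_mul]
          · rw [Set.indicator_of_notMem hy, Set.indicator_of_notMem hy, mul_zero]
      _ = (ENNReal.ofReal W * (q * η))⁻¹ *
          ∑ S, ENNReal.ofReal (γ S) * ∫⁻ θ in B, seqModel θ Fᶜ ∂(component τ S) := by
          rw [lintegral_const_mul _ hNm, hN_def, lintegral_finsetSum _ fun S _ =>
            (measurable_lintegral_likelihood _).const_mul _]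
          congr 1
          refine Finset.sum_congr rfl fun S _ => ?_
          rw [lintegral_const_mul _ (measurable_lintegral_likelihood _),
            setLIntegral_lintegral_likelihood _ hF.compl]
      _ ≤ (ENNReal.ofReal W * (q * η))⁻¹ * ∑ S, ENNReal.ofReal (γ S) *
          (ENNReal.ofReal (Real.exp (6 * sparseRate S + (6 + C₂ - 3 / 16 * M) * r)) * q) := by
          gcongr with S _
          exact setLIntegral_seqModel_accept_le hτ hκ hθ S
      _ = ∑ S, ENNReal.ofReal (γ S / W * Real.exp (6 * sparseRate S) *
            Real.exp ((9 + C₂ - 3 / 16 * M) * r)) := by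
          rw [Finset.mul_sum]
          refine Finset.sum_congr rfl fun S _ => ?_
          have h1 : (ENNReal.ofReal W * (q * η))⁻¹ =
              ENNReal.ofReal W⁻¹ * ENNReal.ofReal (Real.exp (3 * r)) * q⁻¹ := by
            rw [ENNReal.mul_inv (Or.inr (ENNReal.mul_ne_top hq' hη'))
              (Or.inr (mul_ne_zero hq hη)), ENNReal.mul_inv (Or.inl hq) (Or.inl hq'), hη_def,
              ← ENNReal.ofReal_inv_of_pos hW, ← ENNReal.ofReal_inv_of_pos (Real.exp_pos _),
              ← Real.exp_neg, neg_neg, mul_comm q⁻¹, mul_assoc]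
          calc _ = ENNReal.ofReal W⁻¹ * ENNReal.ofReal (Real.exp (3 * r)) * (ENNReal.ofReal (γ S) *
                ENNReal.ofReal (Real.exp (6 * sparseRate S + (6 + C₂ - 3 / 16 * M) * r))) *
                (q⁻¹ * q) := by rw [h1]; ring
            _ = _ := by
                rw [ENNReal.inv_mul_cancel hq hq', mul_one, ← ENNReal.ofReal_mul (by positivity),
                  ← ENNReal.ofReal_mul (hγ0 S), ← ENNReal.ofReal_mul (by positivity)]
                congr 1
                rw [show Real.exp ((9 + C₂ - 3 / 16 * M) * r) = Real.exp (3 * r) *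
                  Real.exp ((6 + C₂ - 3 / 16 * M) * r) by rw [← Real.exp_add]; congr 1; ring,
                  Real.exp_add]
                ring
      _ ≤ ENNReal.ofReal (Real.exp (C₄ * r) * Real.exp ((9 + C₂ - 3 / 16 * M) * r)) := by
          rw [← ENNReal.ofReal_sum_of_nonneg fun S _ => mul_nonneg
            (mul_nonneg (div_nonneg (hγ0 S) hW.le) (Real.exp_nonneg _)) (Real.exp_nonneg _),
            ← Finset.sum_mul]
          refine ENNReal.ofReal_le_ofReal (mul_le_mul_of_nonneg_right
            ((Finset.sum_le_sum fun S _ => ?_).trans hsum) (Real.exp_nonneg _))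
          refine mul_le_mul_of_nonneg_left (Real.exp_le_exp.2 ?_) (div_nonneg (hγ0 S) hW.le)
          have hL := log_natCast_ge hp
          have : 0 ≤ sparseRate S := by unfold sparseRate; positivity
          nlinarith
      _ = _ := by
          rw [← Real.exp_add, hM]
          congr 2; ring
  have hthird : ∫⁻ y, η * q⁻¹ * (likelihood y θstar * V y) ∂(seqModel θstar) ≤
      ENNReal.ofReal (Real.exp (-r)) := by
    calc _ = η * q⁻¹ * ∫⁻ θ in D, ENNReal.ofReal (Real.exp (sqLoss θ θstar))
            ∂(component τ Sstar) := by
          rw [lintegral_const_mul _ hLV, seqModel_eq_withDensity,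
            lintegral_withDensity_eq_lintegral_mul _ hLm hLV,
            ← lintegral_lintegral_likelihood_sq_div]
          rfl
      _ ≤ η * q⁻¹ * ∫⁻ _ in D, ENNReal.ofReal (Real.exp (2 * r)) ∂(component τ Sstar) := by
          refine mul_le_mul_right (setLIntegral_mono measurable_const fun θ hθD => ?_) _
          exact ENNReal.ofReal_le_ofReal (Real.exp_le_exp.2
            (hθD.2.trans (card_le_two_mul_sparseRate hp Sstar)))
      _ = η * ENNReal.ofReal (Real.exp (2 * r)) := by
          rw [setLIntegral_const, ← hq_def, mul_assoc, mul_left_comm q⁻¹,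
            ENNReal.inv_mul_cancel hq hq', mul_one]
      _ = _ := by
          rw [hη_def, ← ENNReal.ofReal_mul (Real.exp_nonneg _), ← Real.exp_add]
          congr 2; ring
  -- Monotonicity needs no measurability of the left side, so `lhat` may be an arbitrary selector.
  calc _ ≤ ∫⁻ y, (F.indicator 1 y +
        Fᶜ.indicator (fun y =>
          (ENNReal.ofReal W * (q * η))⁻¹ * ((likelihood y θstar)⁻¹ * N y)) y +
        η * q⁻¹ * (likelihood y θstar * V y)) ∂(seqModel θstar) :=
        lintegral_mono fun y =>
          posterior_le_split hτ hlhat y hB hγ hlstar Sstar hW θstar hq hη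
    _ = (∫⁻ y, F.indicator 1 y ∂(seqModel θstar)) +
        (∫⁻ y, Fᶜ.indicator (fun y =>
          (ENNReal.ofReal W * (q * η))⁻¹ * ((likelihood y θstar)⁻¹ * N y)) y ∂(seqModel θstar)) +
        ∫⁻ y, η * q⁻¹ * (likelihood y θstar * V y) ∂(seqModel θstar) := by
        rw [lintegral_add_right _ (hLV.const_mul _), lintegral_add_left (measurable_one.indicator hF)]
    _ ≤ ENNReal.ofReal (Real.exp (-r)) + ENNReal.ofReal (Real.exp (-r)) +
        ENNReal.ofReal (Real.exp (-r)) := add_le_add (add_le_add hfirst hsecond) hthird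
    _ ≤ _ := by
        rw [← ENNReal.ofReal_add (Real.exp_nonneg _) (Real.exp_nonneg _),
          ← ENNReal.ofReal_add (by positivity) (Real.exp_nonneg _)]
        refine ENNReal.ofReal_le_ofReal ?_
        linarith [Real.exp_pos (-r)]

end Contraction

theorem slabConst_le_exp_mul_log {τ C₂ : ℝ} {p : ℕ} (hτ : 0 < τ) (hp : 2 ≤ p) (hC₂ : 0 ≤ C₂)
    (h : 2 * Real.log (slabConst τ) ≤ C₂) : slabConst τ ≤ Real.exp (C₂ * Real.log p) := by
  rw [← Real.log_le_iff_le_exp (slabConst_pos hτ)]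
  nlinarith [log_natCast_ge hp]

end EmpiricalBayes

theorem mainTheorem4 (τ : ℝ) (hτ : 0 < τ) :
    ∃ C C₁ C₂ C₃ C₅ K : ℝ, 0 < C ∧ 0 < C₁ ∧ 0 < C₂ ∧ 0 < C₃ ∧ 0 < C₅ ∧ 0 < K ∧ 2 * C₅ < C ∧
    ∀ C₁' C₂' : ℝ, K ≤ C₂' → C₂' < C₁' →
    ∃ C₄ M C' : ℝ, 0 < C₄ ∧ 0 < M ∧ 0 < C' ∧
    ∀ (p : ℕ) (α β : ℝ), 1 ≤ α → (p : ℝ) ^ C₂' ≤ β / α → β / α ≤ (p : ℝ) ^ C₁' →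
    ∀ (Sstar : Finset (Fin p)), ∀ θstar ∈ EmpiricalBayes.supportedOn Sstar,
      (2 ≤ p → Sstar.Nonempty →
        EmpiricalBayes.TestingCondition EmpiricalBayes.seqModel EmpiricalBayes.sqLoss
          EmpiricalBayes.supportedOn EmpiricalBayes.sparseRate θstar Sstar C C₁ C₂ ∧
        EmpiricalBayes.SieveCondition (Set.Icc (0 : ℝ) 1) (EmpiricalBayes.betaWeight α β)
          EmpiricalBayes.componentWeight EmpiricalBayes.sparseRate (fun _ => 1) Sstar C₂ C₄ ∧
        EmpiricalBayes.PriorMassCondition EmpiricalBayes.seqModel EmpiricalBayes.sqLoss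
          EmpiricalBayes.supportedOn (EmpiricalBayes.component τ) EmpiricalBayes.sparseRate
          (fun _ => 1) θstar Sstar 2 C₂ C₃ C₅) ∧
      ∀ lhat : (Fin p → ℝ) → ℝ, EmpiricalBayes.IsEmpiricalBayesSelector τ α β lhat →
        ∫⁻ y, EmpiricalBayes.posterior τ (lhat y) y
            {θ | M * ((Sstar.card : ℝ) * Real.log p) < EmpiricalBayes.sqLoss θ θstar}
          ∂(EmpiricalBayes.seqModel θstar)
          ≤ ENNReal.ofReal (4 * Real.exp (-C' * ((Sstar.card : ℝ) * Real.log p))) := by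
  -- `6` comes from the type-II error; the second bound gives `slabConst τ ≤ p ^ C₂`, as `log p ≥
  -- 1/2`.
  obtain ⟨C₂, hC₂, hC₂τ⟩ : ∃ C₂ : ℝ, 6 ≤ C₂ ∧ 2 * Real.log (EmpiricalBayes.slabConst τ) ≤ C₂ :=
    ⟨_, le_max_left _ _, le_max_right _ _⟩
  refine ⟨1 / 4, 1, C₂, 2, 1 / 16, 3 + 2 * C₂, by norm_num, one_pos, by linarith, two_pos,
    by norm_num, by linarith, by norm_num, fun C₁' C₂' hK hlt => ?_⟩
  refine ⟨C₁' + 4, 16 / 3 * (10 + C₂ + (C₁' + 4)), 1, by linarith, by linarith, one_pos,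
    fun p α β hα hlow hup Sstar θstar hθ => ?_⟩
  have hsieve : 2 ≤ p → Sstar.Nonempty → EmpiricalBayes.SieveCondition (Set.Icc (0 : ℝ) 1)
      (EmpiricalBayes.betaWeight α β) EmpiricalBayes.componentWeight EmpiricalBayes.sparseRate
      (fun _ => 1) Sstar C₂ (C₁' + 4) := fun hp hS =>
    EmpiricalBayes.sieveCondition_betaWeight hp (by linarith) hK hα hlow hup hS
  have hκ := fun hp : 2 ≤ p =>
    EmpiricalBayes.slabConst_le_exp_mul_log hτ hp (by linarith : 0 ≤ C₂) hC₂τ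
  refine ⟨fun hp hS => ⟨EmpiricalBayes.testingCondition_seqModel hp hS hθ hC₂, hsieve hp hS,
    EmpiricalBayes.priorMassCondition_component hτ hp (by linarith) (hκ hp) hθ⟩,
    fun lhat hlhat => ?_⟩
  by_cases h : 2 ≤ p ∧ Sstar.Nonempty
  · rw [neg_one_mul]
    exact EmpiricalBayes.lintegral_posterior_le hτ h.1 hC₂ (hκ h.1) h.2 hθ (hsieve h.1 h.2) hlhat
  -- In the degenerate cases the rate is 0 (with `Real.log 0 = 0` for `p = 0`), so the right side is
  -- 4 and the posterior mass is at most 1.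
  · have hzero : (Sstar.card : ℝ) * Real.log p = 0 := by
      by_cases hp : 2 ≤ p
      · have : Sstar = ∅ := Finset.not_nonempty_iff_eq_empty.1 fun hS => h ⟨hp, hS⟩
        simp [this]
      · have : p = 0 ∨ p = 1 := by omega
        rcases this with rfl | rfl <;> simp
    calc _ ≤ ∫⁻ _, 1 ∂(EmpiricalBayes.seqModel θstar) :=
          lintegral_mono fun y => EmpiricalBayes.posterior_le_one _ _ _
      _ ≤ _ := by
          rw [hzero, lintegral_one, measure_univ]
          simp
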